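/- Let $C$ be a CSS code with finite sets $X$ of $X$-checks, $Q$ of qubits and $Z$ of $Z$-checks and binary parity-check matrices $H_X,H_Z$ with $H_XH_Z^T=0$. Fix a $\mathbb Z$-lift of $C$: integer matrices $\tilde H_X,\tilde H_Z$ that reduce to $H_X,H_Z$ modulo $2$ and satisfy $\tilde H_X\tilde H_Z^T=0$. Let $\widetilde T$ be the signed bipartite multigraph on $X\sqcup Q$ with $|(\tilde H_X)_{x,q}|$ edges of sign $\operatorname{sgn}(\tilde H_X)_{x,q}$ between $x$ and $q$. For $z\in Z$ let $\widetilde T_z\subseteq\widetilde T$ consist of all $q$ with $(\tilde H_Z)_{z,q}\neq0$, all $x$ with $(\tilde H_X)_{x,q}\ne 0$ for such a $q$, and all edges between them. Let $\widetilde T_z^{\rm mult}$ be the graph obtained from $\widetilde T_z$ by taking $|(\tilde H_Z)_{z,q}|$ copies of each $q$, with edge signs multiplied by $\operatorname{sgn}(\tilde H_Z)_{z,q}$. Fix for every $z$ a gluing of its $5$-handle: (a) a pairing of oppositely signed edges at every $X$-vertex of $\widetilde T_z^{\rm mult}$, which defines a graph $G_z$ whose vertices are the copies of the qubits and one bivalent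 copy of $x$ for each pair at $x$; and (b) a thickened embedding of $G_z$ in $S^4$: pairwise disjoint closed $4$-balls, one for each copy of a qubit $q$, parametrised by the cube $[-1,1]^4$ with orientation $\operatorname{sgn}(\tilde H_Z)_{z,q}$, and embedded tubes $[0,1]\times D^3$, one for each pair, which are disjoint from each other, meet the balls only in their ends, and join the little discs that correspond to the two paired edges on the boundaries of the balls (see the $4$-cells below). A cellular realization of $C$ (for these data) is a finite CW complex $L$ with the following cells. - $0$-cells: $X\sqcup Q$. - $1$-cells: the edges of $\widetilde T$, and for each $z$ finitely many "$Z$-type" edges joining vertices of $\widetilde T_z$. - $2$-cells: for each $z$ finitely many $2$-cells attached along loops in the union of $\widetilde T_z$ and the $Z$-type edges of $z$. The subcomplex $\overline T_z$ formed by $\widetilde T_z$, the $Z$-type edges of $z$ and the $2$-cells of $z$ is required to be simply connected. - $3$-cells: one for each $x\in X$, attached by the constant map to $x$; this gives a sphere $S^3_x$. - $4$-cells: one for each $q\in Q$, attached by the following standard map on $\partial[-1,1]^4$. For each edge $e=(x,q)$ there is a little $3$-cube in the boundary, these cubes having disjoint interiors. Its concentric inner cube of half the size (the little disc of $e$) covers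 the open $3$-cell of $S^3_x$ once with degree the sign of $e$, the shell around it is mapped radially along $e$ from $x$ to $q$, and everything else is mapped to $q$. (That is, a $4$-sphere with one puncture per edge at $q$, whose boundary spheres are glued to the spheres $S^3_x$ with degree $\pm1$.) - $5$-cells: one for each $z\in Z$, with an attaching map $S^4\to L$ that on the ball of each copy of $q$ is the characteristic map of the $4$-cell $q$, on each tube over a copy of $x$ is the projection $[0,1]\times D^3\to D^3\to D^3/\partial D^3=S^3_x$, and maps the rest of $S^4$ into $\overline T_z$. - There are no other cells. Let $L_1$ and $L_2$ be two cellular realizations of $C$ for the same $\mathbb Z$-lift and the same gluings of the $5$-handles (they may differ in the $Z$-type edges, in the $2$-cells, and in the part of the attaching maps of the $5$-cells that lies in $\overline T_z$). Write $\overline T_{i,z}\subseteq L_i$ for the subcomplexes $\overline T_z$ of $L_i$, and suppose that $\overline T_{i,z}$ is contractible for all $z\in Z$ and $i=1,2$. Then $L_1$ and $L_2$ are homotopy equivalent. -/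

import Mathlib

open Topology Metric
open scoped Matrix ContinuousMap

noncomputable section

namespace CSSCell

/-- A CSS code, given by its two binary parity-check matrices. Rows of `HX` are the `X`-checks,
rows of `HZ` are the `Z`-checks, and columns are the qubits. -/
structure CSSCode (X Q Z : Type*) [Fintype Q] where
  HX : Matrix X Q (ZMod 2)
  HZ : Matrix Z Q (ZMod 2)
  orth : HX * HZᵀ = 0

/-- A `ℤ`-lift of a CSS code: integer matrices that reduce to the parity-check matrices modulo `2`
and still satisfy the orthogonality relation (`∂₁ = HX`, `∂₂ = HZᵀ`). -/
structure ZLift {X Q Z : Type*} [Fintype Q] (C : CSSCode X Q Z) where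
  HX : Matrix X Q ℤ
  HZ : Matrix Z Q ℤ
  orth : HX * HZᵀ = 0
  map_HX : HX.map (fun a : ℤ => (a : ZMod 2)) = C.HX
  map_HZ : HZ.map (fun a : ℤ => (a : ZMod 2)) = C.HZ

/-- Multiplication of the first coordinate by `s`; a reflection of the cube when `s = -1`. -/
def flip {n : ℕ} (s : ℤ) (v : Fin (n + 1) → ℝ) : Fin (n + 1) → ℝ :=
  Function.update v 0 ((s : ℝ) * v 0)

/-- The point `(v, a)` of `ℝⁿ⁺¹`. -/
def app {n : ℕ} (v : Fin n → ℝ) (a : ℝ) : Fin (n + 1) → ℝ :=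
  Fin.snoc (α := fun _ => ℝ) v a

section Lift

variable {X Q Z : Type*} [Fintype X] [Fintype Q] {C : CSSCode X Q Z} (ℓ : ZLift C)

/-- The edges at `q` of the lifted Tanner multigraph: `|HX x q|` edges between `x` and `q`. -/
abbrev ZLift.Star (q : Q) : Type _ := Σ x : X, Fin (ℓ.HX x q).natAbs

/-- All the edges of the lifted Tanner multigraph. -/
abbrev ZLift.Edge : Type _ := Σ q : Q, ℓ.Star q

/-- For every edge `e` at `q`, a little cube in `[-1,1]³`. The little cubes of the `t` edges at `q`
have side `2/t`, lie side by side along the first axis, and are parametrised by `[-1,1]³` with the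
orientation given by the sign of the edge. -/
def ZLift.disc (q : Q) (e : ℓ.Star q) (u : Fin 3 → ℝ) : Fin 3 → ℝ :=
  Function.update (0 : Fin 3 → ℝ) 0
      (-1 + (2 * ((Fintype.equivFin (ℓ.Star q) e : ℕ) : ℝ) + 1) / (Fintype.card (ℓ.Star q) : ℝ))
    + (Fintype.card (ℓ.Star q) : ℝ)⁻¹ • flip (ℓ.HX e.1 q).sign u

/-- The same little cube, in the bottom face of `[-1,1]⁴`. -/
def ZLift.foot (q : Q) (e : ℓ.Star q) (u : Fin 3 → ℝ) : Fin 4 → ℝ :=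
  app (ℓ.disc q e u) (-1)

/-- The qubit-vertices of the graph with multiplicities of the check `z`: `|HZ z q|` copies
of `q`. -/
abbrev ZLift.Copy (z : Z) : Type _ := Σ q : Q, Fin (ℓ.HZ z q).natAbs

/-- The edges of the graph with multiplicities of the check `z`: every copy of `q` carries a copy
of every edge at `q`. -/
abbrev ZLift.HalfEdge (z : Z) : Type _ := Σ j : ℓ.Copy z, ℓ.Star j.1

/-- The sign of an edge of the graph with multiplicities. -/
def ZLift.halfSign {z : Z} (h : ℓ.HalfEdge z) : ℤ :=
  (ℓ.HZ z h.1.1).sign * (ℓ.HX h.2.1 h.1.1).sign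

/-- The gluing of the dressed `5`-handle of the check `z`.

* `pair` is a pairing of oppositely signed edges at every `X`-vertex of the graph with
  multiplicities. It defines the graph `G_z`: its vertices are the copies of the qubits and, for
  every pair, one bivalent copy of the `X`-vertex.
* `center`, `radius`, `tube` describe a thickening of `G_z` in the attaching `4`-sphere of the
  `5`-cell, that is, the `4`-manifold `Y_z` (copies of the punctured spheres of the
  qubits, joined along tubes `[0,1] × S³` over the copies of the `X`-vertices) as it sits in
  that sphere. Only the part that is not mapped to the `2`-skeleton is recorded: a ball for
  every copy of a qubit, oriented by the sign of `HZ z q`, and for every pair of edges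
  a tube `[0,1] × [-1,1]³` that joins the little discs of the two edges. -/
structure CheckGluing (z : Z) where
  pair : ℓ.HalfEdge z → ℓ.HalfEdge z
  pair_pair : ∀ h, pair (pair h) = h
  pair_x : ∀ h, (pair h).2.1 = h.2.1
  pair_sign : ∀ h, ℓ.halfSign (pair h) = -ℓ.halfSign h
  center : ℓ.Copy z → Fin 4 → ℝ
  radius : ℓ.Copy z → ℝ
  radius_pos : ∀ j, 0 < radius j
  ball_subset : ∀ j, closedBall (center j) (radius j) ⊆ ball 0 1
  ball_disjoint : ∀ j j', j ≠ j' →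
    Disjoint (closedBall (center j) (radius j)) (closedBall (center j') (radius j'))
  tube : ℓ.HalfEdge z → ℝ × (Fin 3 → ℝ) → Fin 4 → ℝ
  tube_continuousOn : ∀ h, ContinuousOn (tube h) (Set.Icc 0 1 ×ˢ closedBall 0 1)
  tube_injOn : ∀ h, Set.InjOn (tube h) (Set.Icc 0 1 ×ˢ closedBall 0 1)
  tube_mapsTo : ∀ h, Set.MapsTo (tube h) (Set.Icc 0 1 ×ˢ closedBall 0 1) (ball 0 1)
  tube_start : ∀ h, ∀ u ∈ closedBall (0 : Fin 3 → ℝ) 1,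
    tube h (0, u) = center h.1 +
      radius h.1 • flip (ℓ.HZ z h.1.1).sign (ℓ.foot h.1.1 h.2 ((1 / 2 : ℝ) • u))
  tube_symm : ∀ h, ∀ t ∈ Set.Icc (0 : ℝ) 1, ∀ u ∈ closedBall (0 : Fin 3 → ℝ) 1,
    tube (pair h) (t, u) = tube h (1 - t, u)
  tube_avoid : ∀ h j, ∀ t ∈ Set.Ioo (0 : ℝ) 1, ∀ u ∈ closedBall (0 : Fin 3 → ℝ) 1,
    tube h (t, u) ∉ closedBall (center j) (radius j)
  tube_disjoint : ∀ h h', h' ≠ h → h' ≠ pair h →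
    Disjoint (tube h '' (Set.Icc 0 1 ×ˢ closedBall 0 1))
      (tube h' '' (Set.Icc 0 1 ×ˢ closedBall 0 1))

variable {ℓ} in
/-- The parametrisation by `[-1,1]⁴` of the ball of a copy `j` of a qubit `q`; it preserves the
orientation if `HZ z q > 0` and reverses it if `HZ z q < 0`. -/
def CheckGluing.ballMap {z : Z} (g : CheckGluing ℓ z) (j : ℓ.Copy z) (u : Fin 4 → ℝ) :
    Fin 4 → ℝ :=
  g.center j + g.radius j • flip (ℓ.HZ z j.1).sign u

variable {ℓ} in
/-- The union of the balls and of the tubes. -/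
def CheckGluing.thick {z : Z} (g : CheckGluing ℓ z) : Set (Fin 4 → ℝ) :=
  (⋃ j, g.ballMap j '' closedBall 0 1) ∪ ⋃ h, g.tube h '' (Set.Icc 0 1 ×ˢ closedBall 0 1)

/-- The names of the cells of a cellular realization, for a CW structure on the whole space `L`
(characteristic maps are defined on the cubes `[-1,1]ⁿ`). There are

* `0`-cells: the `X`-vertices and the `Q`-vertices;
* `1`-cells: the edges of the lifted Tanner multigraph (`Q`-type), and for every `Z`-check finitely
  many `Z`-type edges;
* `2`-cells: for every `Z`-check finitely many faces;
* one `3`-cell for every `X`-check, one `4`-cell for every qubit, one `5`-cell for every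
  `Z`-check; and no other cells. -/
structure CellLabelling (L : Type*) [TopologicalSpace L]
    [CWComplex (Set.univ : Set L)] where
  numEdges : Z → ℕ
  numFaces : Z → ℕ
  cell0 : X ⊕ Q ≃ RelCWComplex.cell (Set.univ : Set L) 0
  cell1 : ℓ.Edge ⊕ (Σ z : Z, Fin (numEdges z)) ≃ RelCWComplex.cell (Set.univ : Set L) 1
  cell2 : (Σ z : Z, Fin (numFaces z)) ≃ RelCWComplex.cell (Set.univ : Set L) 2
  cell3 : X ≃ RelCWComplex.cell (Set.univ : Set L) 3
  cell4 : Q ≃ RelCWComplex.cell (Set.univ : Set L) 4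
  cell5 : Z ≃ RelCWComplex.cell (Set.univ : Set L) 5
  cell_isEmpty : ∀ n, 5 < n → IsEmpty (RelCWComplex.cell (Set.univ : Set L) n)

namespace CellLabelling

variable {ℓ} {L : Type*} [TopologicalSpace L] [CWComplex (Set.univ : Set L)]
  (K : CellLabelling ℓ L)

/-- The vertices, as points of `L`. -/
def vert (v : X ⊕ Q) : L := RelCWComplex.map (C := Set.univ) 0 (K.cell0 v) 0

/-- The vertices of the induced subgraph `T_z` of the lifted Tanner multigraph: the qubits in the
support of `z`, and the `X`-checks with such a qubit in their support. -/
def inducedVertices (z : Z) : Set L :=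
  {p | ∃ q, ℓ.HZ z q ≠ 0 ∧ p = K.vert (Sum.inr q)} ∪
    {p | ∃ x q, ℓ.HZ z q ≠ 0 ∧ ℓ.HX x q ≠ 0 ∧ p = K.vert (Sum.inl x)}

/-- The induced subgraph `T_z`, with all its edges. -/
def inducedGraph (z : Z) : Set L :=
  K.inducedVertices z ∪
    ⋃ (e : ℓ.Edge) (_ : ℓ.HZ z e.1 ≠ 0), RelCWComplex.closedCell 1 (K.cell1 (Sum.inl e))

/-- `T_z` together with the `Z`-type edges of the check `z`. -/
def dressedGraph (z : Z) : Set L :=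
  K.inducedGraph z ∪
    ⋃ i : Fin (K.numEdges z), RelCWComplex.closedCell 1 (K.cell1 (Sum.inr ⟨z, i⟩))

/-- The subcomplex `T̄_z`: the graph `T_z` together with the `1`- and `2`-cells of the dressed
handle of the check `z`. -/
def Tbar (z : Z) : Set L :=
  K.dressedGraph z ∪
    ⋃ i : Fin (K.numFaces z), RelCWComplex.closedCell 2 (K.cell2 ⟨z, i⟩)

end CellLabelling

/-- A cellular realization of the code, for the `ℤ`-lift `ℓ` and the gluings `G` of the
`5`-handles. -/
structure CellularRealization (G : ∀ z : Z, CheckGluing ℓ z) (L : Type*) [TopologicalSpace L]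
    [CWComplex (Set.univ : Set L)] extends CellLabelling ℓ L where
  /-- A `Q`-type edge goes from its `X`-vertex to its `Q`-vertex. -/
  edge_x : ∀ q (e : ℓ.Star q),
    RelCWComplex.map 1 (cell1 (Sum.inl ⟨q, e⟩)) (fun _ => -1) = toCellLabelling.vert (Sum.inl e.1)
  edge_q : ∀ q (e : ℓ.Star q),
    RelCWComplex.map 1 (cell1 (Sum.inl ⟨q, e⟩)) (fun _ => 1) = toCellLabelling.vert (Sum.inr q)
  /-- A `Z`-type edge of the check `z` joins vertices of `T_z`. -/
  zEdge_left : ∀ z (i : Fin (numEdges z)),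
    RelCWComplex.map 1 (cell1 (Sum.inr ⟨z, i⟩)) (fun _ => -1) ∈ toCellLabelling.inducedVertices z
  zEdge_right : ∀ z (i : Fin (numEdges z)),
    RelCWComplex.map 1 (cell1 (Sum.inr ⟨z, i⟩)) (fun _ => 1) ∈ toCellLabelling.inducedVertices z
  /-- The faces of the check `z` are attached along loops in `T_z` and the `Z`-type edges
  of `z`, -/
  face_frontier : ∀ z (i : Fin (numFaces z)),
    RelCWComplex.cellFrontier 2 (cell2 ⟨z, i⟩) ⊆ toCellLabelling.dressedGraph z
  /-- and they make it simply connected. -/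
  simplyConnected : ∀ z, SimplyConnectedSpace (toCellLabelling.Tbar z)
  /-- The dressed core of an `X`-check is the `3`-sphere with one `0`-cell and one `3`-cell. -/
  attach3 : ∀ x, ∀ u ∈ sphere (0 : Fin 3 → ℝ) 1,
    RelCWComplex.map 3 (cell3 x) u = toCellLabelling.vert (Sum.inl x)
  /-- The dressed core of a qubit `q` is a punctured `4`-sphere, with the star of `q` as
  `1`-skeleton rel boundary, whose boundary spheres are glued to the `3`-spheres of the
  `X`-checks, with degree `±1` given by the sign of the edge. In terms of the attaching map
  of the `4`-cell: the inner half of the little cube of an edge `e` covers the `3`-cell once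
  with that degree, -/
  attach4_sphere : ∀ q (e : ℓ.Star q), ∀ u ∈ closedBall (0 : Fin 3 → ℝ) 1, ‖u‖ ≤ 1 / 2 →
    RelCWComplex.map 4 (cell4 q) (ℓ.foot q e u) = RelCWComplex.map 3 (cell3 e.1) ((2 : ℝ) • u)
  /-- the outer half runs radially along the edge, -/
  attach4_edge : ∀ q (e : ℓ.Star q), ∀ u ∈ closedBall (0 : Fin 3 → ℝ) 1, 1 / 2 ≤ ‖u‖ →
    RelCWComplex.map 4 (cell4 q) (ℓ.foot q e u) =
      RelCWComplex.map 1 (cell1 (Sum.inl ⟨q, e⟩)) (fun _ => 4 * ‖u‖ - 3)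
  /-- and everything else goes to the `Q`-vertex. -/
  attach4_vert : ∀ q, ∀ p ∈ sphere (0 : Fin 4 → ℝ) 1,
    (∀ e : ℓ.Star q, p ∉ ℓ.foot q e '' closedBall 0 1) →
      RelCWComplex.map 4 (cell4 q) p = toCellLabelling.vert (Sum.inr q)
  /-- The attaching map of the `5`-cell of `z` (the thickened `G_z` lies in the top face of the
  cube) covers the `4`-cell of `q` once along every copy of `q`, -/
  attach5_ball : ∀ z (j : ℓ.Copy z), ∀ u ∈ closedBall (0 : Fin 4 → ℝ) 1,
    RelCWComplex.map 5 (cell5 z) (app ((G z).ballMap j u) 1) = RelCWComplex.map 4 (cell4 j.1) u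
  /-- it projects the tubes over the copies of an `X`-vertex `x` to the `3`-sphere of `x`, -/
  attach5_tube : ∀ z (h : ℓ.HalfEdge z), ∀ t ∈ Set.Icc (0 : ℝ) 1,
    ∀ u ∈ closedBall (0 : Fin 3 → ℝ) 1,
      RelCWComplex.map 5 (cell5 z) (app ((G z).tube h (t, u)) 1) = RelCWComplex.map 3 (cell3 h.2.1) u
  /-- and it sends the rest of the sphere to the graph `T_z` and the `1`- and `2`-cells of the
  dressed handle of `z`. -/
  attach5_rest : ∀ z, ∀ p ∈ sphere (0 : Fin 5 → ℝ) 1,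
    (∀ v ∈ (G z).thick, p ≠ app v 1) →
      RelCWComplex.map 5 (cell5 z) p ∈ toCellLabelling.Tbar z

end Lift

end CSSCell

end

/-! The cells that two realizations share (vertices, Tanner edges, 3-cells, 4-cells) have completely
prescribed attaching maps, so the unions of these cells, the cores, are canonically homeomorphic
(`exists_coreHomeo`). The 4-skeleton is the core with every `T̄_z` glued in along the graph `T_z`
(`isGlue_Tbar`).

The inclusion of `T_z` in `T̄_z` is a cofibration, and both versions of `T̄_z` are contractible.
Hence the identification of the graphs extends to maps in both directions that are inverse up to
homotopy relative to `T_z`. Gluing these to the homeomorphism of cores gives a homotopy equivalence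
`F` of 4-skeleta that respects the core and carries each `T̄_z` into its counterpart
(`exists_skeletonEquiv`).

Now compare the attaching maps of the 5-cell of `z`, the first one composed with `F`. On the balls
and tubes they agree, since both are prescribed there by core cells; everywhere else both take
values in the second `T̄_z`. Deforming the 4-skeleton so that this contractible cofibrant subspace
is squeezed to a point makes the two maps equal, so they are homotopic
(`HEP.homotopic_of_contractible`).

Finally, attaching cells to homotopy equivalent spaces along maps that correspond up to homotopy
gives homotopy equivalent spaces (`IsGlue.homotopyEquiv_of_homotopic`). This is proved inside the
mapping cylinder of `F`, which deformation retracts to both ends. -/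

noncomputable section

open scoped unitInterval

namespace CSSCell

universe u v w x y

/-! ### Cofibrations and their consequences for contractible targets and deformation retracts. -/

/-- The homotopy extension property of a map `i`, in curried form. -/
def HEP {A : Type u} {X : Type v} [TopologicalSpace A] [TopologicalSpace X] (i : C(A, X)) : Prop :=
  ∀ (Y : Type w) [TopologicalSpace Y] (f : C(X, Y)) (h : C(A, C(I, Y))),
    (∀ a, h a 0 = f (i a)) → ∃ H : C(X, C(I, Y)), (∀ x, H x 0 = f x) ∧ ∀ a, H (i a) = h a

section HEP

variable {A X B Y : Type*} [TopologicalSpace A] [TopologicalSpace X] [TopologicalSpace B]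
  [TopologicalSpace Y]

theorem HEP.comp {i : C(A, X)} {j : C(X, B)} (hj : HEP.{_, _, w} j) (hi : HEP.{_, _, w} i) :
    HEP.{_, _, w} (j.comp i) := by
  intro Y _ f h h0
  obtain ⟨H, H0, Hi⟩ := hi Y (f.comp j) h h0
  obtain ⟨H', H0', Hi'⟩ := hj Y f H H0
  exact ⟨H', H0', fun a => (Hi' _).trans (Hi a)⟩

theorem HEP.homeomorph (e : A ≃ₜ X) : HEP.{_, _, w} (e : C(A, X)) := by
  intro Y _ f h h0
  refine ⟨h.comp (e.symm : C(X, A)), fun x => ?_, fun a => ?_⟩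
  · simpa using h0 (e.symm x)
  · simp

theorem HEP.sigma {ι : Type*} {A X : ι → Type*} [∀ k, TopologicalSpace (A k)]
    [∀ k, TopologicalSpace (X k)] (i : ∀ k, C(A k, X k)) (hi : ∀ k, HEP.{_, _, w} (i k))
    (j : C(Σ k, A k, Σ k, X k)) (hj : ∀ k a, j ⟨k, a⟩ = ⟨k, i k a⟩) :
    HEP.{_, _, w} j := by
  intro Y _ f h h0
  have := fun k => hi k Y (f.comp ⟨Sigma.mk k, continuous_sigmaMk⟩)
    (h.comp ⟨Sigma.mk k, continuous_sigmaMk⟩) (fun a => by simpa [hj] using h0 ⟨k, a⟩)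
  choose H H0 Hi using this
  refine ⟨⟨fun x => H x.1 x.2, continuous_sigma fun k => (H k).continuous⟩, fun x => H0 x.1 x.2, ?_⟩
  rintro ⟨k, a⟩
  simpa [hj] using Hi k a

/-- The homotopy extension property is inherited by the product with the interval. -/
theorem HEP.prod_interval {i : C(A, X)} (hi : HEP.{_, _, w} i) :
    HEP.{_, _, w} (i.prodMap (ContinuousMap.id I)) := by
  intro Y _ f h h0
  -- The interval factor moves into the target, so that `hi` applies to maps into `C(I, Y)`; the two
  -- interval variables trade places.
  let h' : C(A, C(I, C(I, Y))) := ContinuousMap.curry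
    (ContinuousMap.curry ⟨fun p : (A × I) × I => h (p.1.1, p.2) p.1.2, by fun_prop⟩)
  obtain ⟨H, H0, Hi⟩ := hi C(I, Y) f.curry h' (fun a => by ext t; exact h0 (a, t))
  refine ⟨ContinuousMap.curry ⟨fun p : (X × I) × I => H p.1.1 p.2 p.1.2, by fun_prop⟩, ?_, ?_⟩
  · rintro ⟨x, t⟩
    exact congrArg (fun k : C(I, Y) => k t) (H0 x)
  · rintro ⟨a, t⟩
    ext s
    exact congrArg (fun k : C(I, C(I, Y)) => k s t) (Hi a)

/-- Two maps that agree on `A` and that become equal along homotopies which agree on `A` are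
homotopic relative to `A`. -/
theorem HEP.homotopy_rel {A : Type u} {X : Type v} [TopologicalSpace A] [TopologicalSpace X]
    {Y : Type w} [TopologicalSpace Y] {i : C(A, X)} (hi : HEP.{_, _, w} i)
    (h h' : C(X, C(I, Y))) (h1 : ∀ x, h x 1 = h' x 1) (hA : ∀ a, h (i a) = h' (i a)) :
    ∃ k : C(X, C(I, Y)), (∀ x, k x 0 = h x 0) ∧ (∀ x, k x 1 = h' x 0) ∧
      ∀ a t, k (i a) t = h (i a) 0 := by
  let pr (r : ℝ) : I := Set.projIcc 0 1 zero_le_one r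
  have hpr : Continuous pr := continuous_projIcc
  have pr0 : ∀ r ≤ 0, pr r = 0 := fun r hr => Set.projIcc_of_le_left _ hr
  have pr1 : ∀ r ≥ 1, pr r = 1 := fun r hr => Set.projIcc_of_right_le _ hr
  -- `h` followed by the reverse of `h'`. On `A` this path runs out and back along the same track.
  let G : C(X, C(I, Y)) := ContinuousMap.curry
    ⟨fun p : X × I => if (p.2 : ℝ) ≤ 1 / 2 then h p.1 (pr (2 * p.2)) else h' p.1 (pr (2 - 2 * p.2)),
      Continuous.if_le (by fun_prop) (by fun_prop) (by fun_prop) (by fun_prop) (by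
        intro p hp
        rw [hp, pr1 _ (by norm_num), pr1 _ (by norm_num), h1])⟩
  have hG : ∀ x t, G x t = if (t : ℝ) ≤ 1 / 2 then h x (pr (2 * t)) else h' x (pr (2 - 2 * t)) :=
    fun _ _ => rfl
  -- Shrinks the out-and-back path on `A` to the constant path at its starting point.
  let κ : C(A, C(I, C(I, Y))) := ContinuousMap.curry (ContinuousMap.curry
    ⟨fun p : (A × I) × I => h (i p.1.1) (pr (min (2 * (p.2 : ℝ)) (2 - 2 * (p.2 : ℝ)) * (1 - (p.1.2 : ℝ)))),
      by fun_prop⟩)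
  obtain ⟨K, K0, KA⟩ := hi C(I, Y) G κ (by
    intro a
    ext t
    change h (i a) (pr (min (2 * (t : ℝ)) (2 - 2 * (t : ℝ)) * (1 - (0 : ℝ)))) = _
    rw [hG]
    split_ifs with ht
    · rw [min_eq_left (by linarith)]; simp
    · rw [min_eq_right (by linarith), ← hA]; simp)
  -- `K x` is a square with `G x` on one side. The new homotopy runs along the other three sides,
  -- where `κ` is constant in the path variable.
  refine ⟨ContinuousMap.curry ⟨fun p : X × I =>
    K p.1 (pr (min (3 * p.2) (3 - 3 * p.2))) (pr (3 * p.2 - 1)), by fun_prop⟩, ?_, ?_, ?_⟩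
  · intro x
    change K x (pr (min (3 * (0 : ℝ)) (3 - 3 * (0 : ℝ)))) (pr (3 * (0 : ℝ) - 1)) = _
    rw [pr0 _ (by norm_num), pr0 _ (by norm_num), K0, hG]
    simp [pr0]
  · intro x
    change K x (pr (min (3 * (1 : ℝ)) (3 - 3 * (1 : ℝ)))) (pr (3 * (1 : ℝ) - 1)) = _
    rw [pr0 _ (by norm_num), pr1 _ (by norm_num), K0, hG]
    rw [if_neg (by norm_num)]
    simp [pr0]
  · intro a t
    change K (i a) (pr (min (3 * (t : ℝ)) (3 - 3 * (t : ℝ)))) (pr (3 * (t : ℝ) - 1)) = _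
    rw [KA]
    change h (i a) (pr (min (2 * (pr (3 * (t : ℝ) - 1) : ℝ)) (2 - 2 * (pr (3 * (t : ℝ) - 1) : ℝ)) *
      (1 - (pr (min (3 * (t : ℝ)) (3 - 3 * (t : ℝ))) : ℝ)))) = _
    congr 1
    rcases le_total (3 * (t : ℝ)) 1 with ht | ht
    · rw [pr0 (3 * (t : ℝ) - 1) (by linarith)]
      apply pr0; simp
    rcases le_total 2 (3 * (t : ℝ)) with ht' | ht'
    · rw [pr1 (3 * (t : ℝ) - 1) (by linarith)]
      apply pr0; norm_num
    · rw [pr1 (min _ _) (le_min (by linarith) (by linarith))]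
      apply pr0; simp

/-- A contraction, in curried form. -/
theorem exists_contraction (Y : Type*) [TopologicalSpace Y] [ContractibleSpace Y] :
    ∃ (c : C(Y, C(I, Y))) (y₀ : Y), (∀ y, c y 0 = y) ∧ ∀ y, c y 1 = y₀ := by
  obtain ⟨y₀, ⟨H⟩⟩ := id_nullhomotopic Y
  exact ⟨ContinuousMap.curry ⟨fun p : Y × I => H (p.2, p.1), by fun_prop⟩, y₀,
    fun y => H.apply_zero y, fun y => H.apply_one y⟩

/-- A constant map extends to all of `X`; running a contraction of `Y` backwards on `A` and
extending this homotopy ends in an extension of `f`. -/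
theorem HEP.exists_extension {Y : Type w} [TopologicalSpace Y] [ContractibleSpace Y] {i : C(A, X)}
    (hi : HEP.{_, _, w} i) (f : C(A, Y)) : ∃ g : C(X, Y), ∀ a, g (i a) = f a := by
  obtain ⟨c, y₀, c0, c1⟩ := exists_contraction Y
  obtain ⟨H, -, Hi⟩ := hi Y (ContinuousMap.const X y₀) (ContinuousMap.curry
    ⟨fun p : A × I => c (f p.1) (unitInterval.symm p.2), by fun_prop⟩) (fun a => by simp [c1])
  refine ⟨⟨fun x => H x 1, by fun_prop⟩, fun a => ?_⟩
  simp [Hi, c0]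

/-- One contraction of `Y` moves both maps to the same constant, by homotopies that agree on `A`;
`HEP.homotopy_rel` makes the result relative to `A`. -/
theorem HEP.homotopy_rel_of_contractible {Y : Type w} [TopologicalSpace Y] [ContractibleSpace Y]
    {i : C(A, X)} (hi : HEP.{_, _, w} i) (f g : C(X, Y)) (hfg : ∀ a, f (i a) = g (i a)) :
    ∃ k : C(X, C(I, Y)), (∀ x, k x 0 = f x) ∧ (∀ x, k x 1 = g x) ∧ ∀ a t, k (i a) t = f (i a) := by
  obtain ⟨c, y₀, c0, c1⟩ := exists_contraction Y
  obtain ⟨k, k0, k1, kA⟩ := hi.homotopy_rel (c.comp f) (c.comp g) (fun x => by simp [c1])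
    (fun a => by simp [hfg])
  exact ⟨k, by simpa [c0] using k0, by simpa [c0] using k1, by simpa [c0] using kA⟩

/-- The inclusion of a strong deformation retract. -/
def IsSDR (i : C(A, X)) : Prop :=
  ∃ (r : C(X, A)) (k : C(X, C(I, X))), (∀ a, r (i a) = a) ∧ (∀ x, k x 0 = x) ∧
    (∀ x, k x 1 = i (r x)) ∧ ∀ a t, k (i a) t = i a

/-- Homotopies in curried form. -/
theorem homotopic_iff {f g : C(X, Y)} :
    f.Homotopic g ↔ ∃ k : C(X, C(I, Y)), (∀ x, k x 0 = f x) ∧ ∀ x, k x 1 = g x := by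
  constructor
  · rintro ⟨H⟩
    exact ⟨ContinuousMap.curry ⟨fun p : X × I => H (p.2, p.1), by fun_prop⟩,
      fun x => H.apply_zero x, fun x => H.apply_one x⟩
  · rintro ⟨k, k0, k1⟩
    exact ⟨⟨⟨fun p : I × X => k p.2 p.1, by fun_prop⟩, k0, k1⟩⟩

/-- Homotopy extension first deforms the homotopy inverse `g` to a strict retraction `r`, then makes
the homotopy from the identity to `i ∘ r` stationary on `A`. The two extension hypotheses serve
targets in the universes of `A` and of `X`. -/
theorem HEP.isSDR {A : Type u} {X : Type v} [TopologicalSpace A] [TopologicalSpace X] {i : C(A, X)}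
    (hA : HEP.{_, _, u} i) (hX : HEP.{_, _, v} i) (g : C(X, A))
    (h₁ : (g.comp i).Homotopic (ContinuousMap.id A))
    (h₂ : (i.comp g).Homotopic (ContinuousMap.id X)) : IsSDR i := by
  obtain ⟨h, h0, h1⟩ := homotopic_iff.1 h₁
  obtain ⟨H, H0, Hi⟩ := hA A g h h0
  let r : C(X, A) := ⟨fun x => H x 1, by fun_prop⟩
  have hr : ∀ a, r (i a) = a := fun a => by
    change H (i a) 1 = a
    rw [Hi]; exact h1 a
  have hgr : g.Homotopic r := homotopic_iff.2 ⟨H, H0, fun x => rfl⟩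
  obtain ⟨G, G0, G1⟩ := homotopic_iff.1
    (h₂.symm.trans ((ContinuousMap.Homotopic.refl i).comp hgr))
  -- `G` and `G ∘ i ∘ r` end at the same map and agree on `A`, because `r ∘ i` is the identity;
  -- their starting maps are the identity and `i ∘ r`.
  obtain ⟨k, k0, k1, kA⟩ := hX.homotopy_rel G (G.comp (i.comp r))
    (fun x => by simp [G1, hr]) (fun a => by simp [hr])
  refine ⟨r, k, hr, fun x => (k0 x).trans (G0 x), fun x => (k1 x).trans (G0 _), fun a t => ?_⟩
  exact (kA a t).trans (G0 _)

/-- Two maps that agree outside of the preimages of a contractible cofibrant subspace are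
homotopic. -/
theorem HEP.homotopic_of_contractible {T : Type u} {K : Type v} {S : Type*} [TopologicalSpace T] [TopologicalSpace K]
    [TopologicalSpace S] [ContractibleSpace T] {i : C(T, K)} (hi : HEP.{_, _, v} i)
    (f g : C(S, K))
    (h : ∀ s, f s = g s ∨ (f s ∈ Set.range i ∧ g s ∈ Set.range i)) : f.Homotopic g := by
  obtain ⟨c, y₀, c0, c1⟩ := exists_contraction T
  -- The contraction of `T` extends to a deformation of `K` whose final map sends `T` to one point,
  -- and hence equalizes `f` and `g`.
  obtain ⟨H, H0, HA⟩ := hi K (ContinuousMap.id K) (ContinuousMap.curry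
    ⟨fun p : T × I => i (c p.1 p.2), by fun_prop⟩) (fun a => by simp [c0])
  have key : ∀ f : C(S, K), f.Homotopic ⟨fun s => H (f s) 1, by fun_prop⟩ := fun f =>
    homotopic_iff.2 ⟨H.comp f, fun x => H0 _, fun x => rfl⟩
  have he : ∀ t, H (i t) 1 = i y₀ := fun t => by rw [HA]; simp [c1]
  refine (key f).trans (ContinuousMap.Homotopic.trans ?_ (key g).symm)
  convert ContinuousMap.Homotopic.refl _ using 2
  ext s
  rcases h s with h | ⟨⟨a, ha⟩, ⟨b, hb⟩⟩
  · simp [h]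
  · simp [← ha, ← hb, he]

end HEP

/-! ### Homotopy extension for the boundary of a cube. -/

section Ball

/-- The inclusion of the boundary of a cube. -/
def sphereIncl (n : ℕ) : C(sphere (0 : Fin n → ℝ) 1, closedBall (0 : Fin n → ℝ) 1) :=
  ⟨Set.inclusion sphere_subset_closedBall, continuous_inclusion _⟩

/-- At time `t` a copy of `f` is shrunk to the cube of radius `1 - t/2`, and the shell around it
carries `h`, from time `0` on the inner wall to time `t` on the boundary. The factor `1/2` keeps the
radius away from zero. -/
theorem hep_sphereIncl (n : ℕ) : HEP.{_, _, w} (sphereIncl n) := by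
  intro Y _ f h h0
  have key : ∀ p : closedBall (0 : Fin n → ℝ) 1 × I, (1 / 2 : ℝ) ≤ 1 - p.2 / 2 := fun p => by
    have := p.2.2.2; linarith
  -- The maximum makes the rescaled point lie in the cube even outside the inner region, so that
  -- this branch is continuous everywhere.
  have hin : ∀ p : closedBall (0 : Fin n → ℝ) 1 × I,
      (max ‖(p.1 : Fin n → ℝ)‖ (1 - p.2 / 2))⁻¹ • (p.1 : Fin n → ℝ) ∈
        closedBall (0 : Fin n → ℝ) 1 := fun p => by
    have hm : 0 < max ‖(p.1 : Fin n → ℝ)‖ (1 - p.2 / 2) :=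
      lt_max_of_lt_right (by linarith [key p])
    rw [mem_closedBall_zero_iff, norm_smul, norm_inv, Real.norm_eq_abs, abs_of_pos hm,
      inv_mul_le_iff₀ hm, mul_one]
    exact le_max_left _ _
  have hout : ∀ p : closedBall (0 : Fin n → ℝ) 1 × I, 1 - p.2 / 2 ≤ ‖(p.1 : Fin n → ℝ)‖ →
      ‖(p.1 : Fin n → ℝ)‖⁻¹ • (p.1 : Fin n → ℝ) ∈ sphere (0 : Fin n → ℝ) 1 := fun p hp => by
    have : ‖(p.1 : Fin n → ℝ)‖ ≠ 0 := by linarith [key p]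
    rw [mem_sphere_zero_iff_norm, norm_smul, norm_inv, norm_norm, inv_mul_cancel₀ this]
  let pr (r : ℝ) : I := Set.projIcc 0 1 zero_le_one r
  have hpr : Continuous pr := continuous_projIcc
  let H : closedBall (0 : Fin n → ℝ) 1 × I → Y := fun p =>
    if hp : 1 - p.2 / 2 ≤ ‖(p.1 : Fin n → ℝ)‖ then
      h ⟨_, hout p hp⟩ (pr (2 - (2 - p.2) / ‖(p.1 : Fin n → ℝ)‖)) else f ⟨_, hin p⟩
  have hH : Continuous H := by
    have hu : {p : closedBall (0 : Fin n → ℝ) 1 × I | 1 - p.2 / 2 ≤ ‖(p.1 : Fin n → ℝ)‖} ∪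
        {p : closedBall (0 : Fin n → ℝ) 1 × I | ‖(p.1 : Fin n → ℝ)‖ ≤ 1 - p.2 / 2} = Set.univ := by
      ext p; simp only [Set.mem_union, Set.mem_ofPred_eq, Set.mem_univ, iff_true]; exact le_total _ _
    rw [← continuousOn_univ, ← hu]
    refine ContinuousOn.union_of_isClosed ?_ ?_ (isClosed_le (by fun_prop) (by fun_prop))
      (isClosed_le (by fun_prop) (by fun_prop))
    · rw [continuousOn_iff_continuous_domRestrict]
      have : Continuous (fun p : {p : closedBall (0 : Fin n → ℝ) 1 × I |
          1 - p.2 / 2 ≤ ‖(p.1 : Fin n → ℝ)‖} =>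
            h ⟨_, hout p.1 p.2⟩ (pr (2 - (2 - p.1.2) / ‖(p.1.1 : Fin n → ℝ)‖))) := by
        have hne : ∀ p : {p : closedBall (0 : Fin n → ℝ) 1 × I |
          1 - p.2 / 2 ≤ ‖(p.1 : Fin n → ℝ)‖}, ‖(p.1.1 : Fin n → ℝ)‖ ≠ 0 := fun p => by
            have h1 := key p.1; have h2 := p.2
            simp only [Set.mem_ofPred_eq] at h2
            linarith
        have h1 : Continuous (fun p : {p : closedBall (0 : Fin n → ℝ) 1 × I |
          1 - p.2 / 2 ≤ ‖(p.1 : Fin n → ℝ)‖} => ‖(p.1.1 : Fin n → ℝ)‖⁻¹) :=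
          Continuous.inv₀ (by fun_prop) hne
        have h2 : Continuous (fun p : {p : closedBall (0 : Fin n → ℝ) 1 × I |
          1 - p.2 / 2 ≤ ‖(p.1 : Fin n → ℝ)‖} =>
            (⟨_, hout p.1 p.2⟩ : sphere (0 : Fin n → ℝ) 1)) :=
          Continuous.subtype_mk (h1.smul (by fun_prop)) _
        have h3 : Continuous (fun p : {p : closedBall (0 : Fin n → ℝ) 1 × I |
          1 - p.2 / 2 ≤ ‖(p.1 : Fin n → ℝ)‖} =>
            pr (2 - (2 - p.1.2) / ‖(p.1.1 : Fin n → ℝ)‖)) := by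
          simp only [div_eq_mul_inv] at h1 ⊢
          fun_prop
        fun_prop
      convert this using 2 with p
      exact dif_pos p.2
    · have : Continuous (fun p : closedBall (0 : Fin n → ℝ) 1 × I => f ⟨_, hin p⟩) := by
        have h1 : Continuous (fun p : closedBall (0 : Fin n → ℝ) 1 × I =>
          (max ‖(p.1 : Fin n → ℝ)‖ (1 - p.2 / 2))⁻¹) :=
          Continuous.inv₀ (by fun_prop) fun p =>
            (lt_max_of_lt_right (by linarith [key p])).ne'
        have h2 : Continuous (fun p : closedBall (0 : Fin n → ℝ) 1 × I =>
            (⟨_, hin p⟩ : closedBall (0 : Fin n → ℝ) 1)) :=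
          Continuous.subtype_mk (h1.smul (by fun_prop)) _
        fun_prop
      refine this.continuousOn.congr fun p hp => ?_
      simp only [H]
      split_ifs with hp'
      · have he : ‖(p.1 : Fin n → ℝ)‖ = 1 - p.2 / 2 := le_antisymm hp hp'
        have h2 : (1 : ℝ) - p.2 / 2 ≠ 0 := by linarith [key p]
        have h3 : pr (2 - (2 - p.2) / ‖(p.1 : Fin n → ℝ)‖) = 0 := by
          apply Set.projIcc_of_le_left
          rw [he, show (2 : ℝ) - p.2 = 2 * (1 - p.2 / 2) by ring, mul_div_cancel_right₀ _ h2]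
          simp
        rw [h3, h0]
        congr 1
        ext1
        simp [sphereIncl, he]
      · rfl
  refine ⟨ContinuousMap.curry ⟨H, hH⟩, fun x => ?_, fun s => ?_⟩
  · change H (x, 0) = f x
    have hx := mem_closedBall_zero_iff.1 x.2
    simp only [H]
    split_ifs with hp'
    · simp only [Set.Icc.coe_zero, zero_div, sub_zero] at hp'
      have hx1 : ‖(x : Fin n → ℝ)‖ = 1 := le_antisymm hx hp'
      have h3 : pr (2 - (2 - (0 : I)) / ‖(x : Fin n → ℝ)‖) = 0 := by
        apply Set.projIcc_of_le_left
        rw [hx1]; simp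
      rw [h3, h0]
      congr 1
      ext1
      simp [sphereIncl, hx1]
    · congr 1
      ext1
      simp [max_eq_right hx]
  · ext t
    change H (sphereIncl n s, t) = h s t
    have hs : ‖(s : Fin n → ℝ)‖ = 1 := mem_sphere_zero_iff_norm.1 s.2
    have ht := t.2.1
    have hp : 1 - (t : ℝ) / 2 ≤ ‖((sphereIncl n s : closedBall (0 : Fin n → ℝ) 1) : Fin n → ℝ)‖ := by
      change _ ≤ ‖(s : Fin n → ℝ)‖
      rw [hs]; linarith
    simp only [H]
    rw [dif_pos hp]
    congr 1
    · congr 1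
      ext1
      simp [sphereIncl, hs]
    · ext1
      simp [sphereIncl, hs, pr]

end Ball

/-! ### Pushouts and maps out of them. -/

section Pushout

variable {S D A B Y : Type*} [TopologicalSpace S] [TopologicalSpace D] [TopologicalSpace A]
  [TopologicalSpace B] [TopologicalSpace Y]

/-- The relation that glues `D` to `A` along `S`. -/
def GlueRel (ρ : C(S, D)) (φ : C(S, A)) (x y : A ⊕ D) : Prop :=
  ∃ s, x = Sum.inl (φ s) ∧ y = Sum.inr (ρ s)

/-- `B` is the pushout of `A` and `D` along `S`. -/
structure IsGlue (ρ : C(S, D)) (φ : C(S, A)) (a : C(A, B)) (χ : C(D, B)) : Prop where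
  comm : ∀ s, a (φ s) = χ (ρ s)
  isQuotientMap : IsQuotientMap (Sum.elim a χ)
  eqvGen : ∀ x y, Sum.elim a χ x = Sum.elim a χ y → Relation.EqvGen (GlueRel ρ φ) x y

variable {ρ : C(S, D)} {φ : C(S, A)} {a : C(A, B)} {χ : C(D, B)}

theorem IsGlue.desc (hB : IsGlue ρ φ a χ) (f : C(A, Y)) (g : C(D, Y))
    (h : ∀ s, f (φ s) = g (ρ s)) :
    ∃ k : C(B, Y), (∀ x, k (a x) = f x) ∧ ∀ d, k (χ d) = g d := by
  have key : ∀ x y, Relation.EqvGen (GlueRel ρ φ) x y → Sum.elim f g x = Sum.elim f g y := by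
    intro x y hxy
    induction hxy with
    | rel x y hxy => obtain ⟨s, rfl, rfl⟩ := hxy; exact h s
    | refl x => rfl
    | symm x y _ ih => exact ih.symm
    | trans x y z _ _ ih₁ ih₂ => exact ih₁.trans ih₂
  let F : C(A ⊕ D, Y) := ⟨Sum.elim f g, by fun_prop⟩
  let q : C(A ⊕ D, B) := ⟨Sum.elim a χ, by fun_prop⟩
  have hq : IsQuotientMap q := hB.isQuotientMap
  have hF : ∀ x y, q x = q y → F x = F y := fun x y hxy => key _ _ (hB.eqvGen x y hxy)
  have hl : ∀ x, hq.lift F hF (q x) = F x :=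
    fun x => congrArg (fun k : C(A ⊕ D, Y) => k x) (hq.lift_comp F hF)
  exact ⟨hq.lift F hF, fun x => hl (Sum.inl x), fun d => hl (Sum.inr d)⟩

theorem IsGlue.cases (hB : IsGlue ρ φ a χ) (b : B) : (∃ x, a x = b) ∨ ∃ d, χ d = b := by
  obtain ⟨x | d, h⟩ := hB.isQuotientMap.surjective b
  exacts [Or.inl ⟨x, h⟩, Or.inr ⟨d, h⟩]

theorem IsGlue.hom_ext (hB : IsGlue ρ φ a χ) {f g : C(B, Y)} (h₁ : ∀ x, f (a x) = g (a x))
    (h₂ : ∀ d, f (χ d) = g (χ d)) : f = g := by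
  ext b
  rcases hB.cases b with ⟨x, rfl⟩ | ⟨d, rfl⟩
  exacts [h₁ x, h₂ d]

/-- Homotopies are maps into `C(I, Y)`, so `IsGlue.desc` glues them directly and no product of a
quotient map with the interval is needed. -/
theorem IsGlue.hep (hB : IsGlue ρ φ a χ) (hρ : HEP.{_, _, w} ρ) : HEP.{_, _, w} a := by
  intro Y _ f h h0
  obtain ⟨H, H0, HS⟩ := hρ Y (f.comp χ) (h.comp φ) (fun s => by simp [h0, hB.comm])
  obtain ⟨k, ka, kχ⟩ := hB.desc h H (fun s => (HS s).symm)
  refine ⟨k, fun b => ?_, ka⟩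
  rcases hB.cases b with ⟨x, rfl⟩ | ⟨d, rfl⟩
  · rw [ka, h0]
  · rw [kχ, H0]; rfl

/-- To attach `D` to `A` injectively outside of `S`. -/
theorem IsGlue.of_injective (comm : ∀ s, a (φ s) = χ (ρ s))
    (hq : IsQuotientMap (Sum.elim a χ)) (ha : Function.Injective a)
    (hdisj : ∀ d x, χ d = a x → d ∈ Set.range ρ)
    (hinj : ∀ d d', χ d = χ d' → d = d' ∨ (d ∈ Set.range ρ ∧ d' ∈ Set.range ρ)) :
    IsGlue ρ φ a χ := by
  have aux : ∀ x d, a x = χ d → Relation.EqvGen (GlueRel ρ φ) (Sum.inl x) (Sum.inr d) := by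
    intro x d h
    obtain ⟨s, rfl⟩ := hdisj d x h.symm
    rw [← comm] at h
    obtain rfl := ha h
    exact Relation.EqvGen.rel _ _ ⟨s, rfl, rfl⟩
  refine ⟨comm, hq, ?_⟩
  rintro (x | d) (y | e) h
  · obtain rfl := ha h
    exact Relation.EqvGen.refl _
  · exact aux _ _ h
  · exact (aux _ _ h.symm).symm
  · rcases hinj d e h with rfl | ⟨⟨s, rfl⟩, ⟨s', rfl⟩⟩
    · exact Relation.EqvGen.refl _
    · have h' : a (φ s) = a (φ s') := by rw [comm, comm]; exact h
      have h1 := aux (φ s) (ρ s) (comm s)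
      have h2 := aux (φ s) (ρ s') (h'.trans (comm s'))
      exact h1.symm.trans _ _ _ h2

/-- The glued space. -/
def Glue (ρ : C(S, D)) (φ : C(S, A)) : Type _ := Quot (GlueRel ρ φ)

instance (ρ : C(S, D)) (φ : C(S, A)) : TopologicalSpace (Glue ρ φ) :=
  inferInstanceAs (TopologicalSpace (Quot (GlueRel ρ φ)))

def Glue.inl (ρ : C(S, D)) (φ : C(S, A)) : C(A, Glue ρ φ) :=
  ⟨fun x => Quot.mk _ (Sum.inl x), continuous_quot_mk.comp continuous_inl⟩

def Glue.inr (ρ : C(S, D)) (φ : C(S, A)) : C(D, Glue ρ φ) :=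
  ⟨fun x => Quot.mk _ (Sum.inr x), continuous_quot_mk.comp continuous_inr⟩

theorem Glue.isGlue (ρ : C(S, D)) (φ : C(S, A)) :
    IsGlue ρ φ (Glue.inl ρ φ) (Glue.inr ρ φ) := by
  have h : Sum.elim (Glue.inl ρ φ) (Glue.inr ρ φ) = Quot.mk (GlueRel ρ φ) := by
    ext (x | x) <;> rfl
  refine ⟨fun s => Quot.sound ⟨s, rfl, rfl⟩, ?_, fun x y hxy => ?_⟩
  · rw [h]; exact isQuotientMap_quot_mk
  · rw [h] at hxy; exact Quot.eqvGen_exact hxy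

/-- A self-map of a pushout that is the identity on `A` is homotopic to the identity if it is
induced by a self-map of `D` that is homotopic to the identity relative to `S`. -/
theorem IsGlue.homotopic_id (hB : IsGlue ρ φ a χ) (u : C(B, B)) (m : C(D, D))
    (ua : ∀ x, u (a x) = a x) (uχ : ∀ d, u (χ d) = χ (m d)) (k : C(D, C(I, D)))
    (k0 : ∀ d, k d 0 = m d) (k1 : ∀ d, k d 1 = d) (kS : ∀ s t, k (ρ s) t = ρ s) :
    u.Homotopic (ContinuousMap.id B) := by
  obtain ⟨K, Ka, Kχ⟩ := hB.desc (ContinuousMap.curry ⟨fun p : A × I => a p.1, by fun_prop⟩)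
    (ContinuousMap.curry ⟨fun p : D × I => χ (k p.1 p.2), by fun_prop⟩)
    (fun s => by ext t; simpa [kS] using hB.comm s)
  refine homotopic_iff.2 ⟨K, fun b => ?_, fun b => ?_⟩
  · rcases hB.cases b with ⟨x, rfl⟩ | ⟨d, rfl⟩
    · simp [Ka, ua]
    · simp [Kχ, uχ, k0]
  · rcases hB.cases b with ⟨x, rfl⟩ | ⟨d, rfl⟩
    · simp [Ka]
    · simp [Kχ, k1]

/-- Pushouts of spaces that are homotopy equivalent relative to `S`. -/
theorem IsGlue.homotopyEquiv {D₁ D₂ B₁ B₂ : Type*} [TopologicalSpace D₁] [TopologicalSpace D₂]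
    [TopologicalSpace B₁] [TopologicalSpace B₂] {ρ₁ : C(S, D₁)} {ρ₂ : C(S, D₂)}
    {a₁ : C(A, B₁)} {a₂ : C(A, B₂)} {χ₁ : C(D₁, B₁)} {χ₂ : C(D₂, B₂)}
    (hB₁ : IsGlue ρ₁ φ a₁ χ₁) (hB₂ : IsGlue ρ₂ φ a₂ χ₂) (f : C(D₁, D₂)) (g : C(D₂, D₁))
    (hf : ∀ s, f (ρ₁ s) = ρ₂ s) (hg : ∀ s, g (ρ₂ s) = ρ₁ s)
    (k₁ : C(D₁, C(I, D₁))) (k₁0 : ∀ d, k₁ d 0 = g (f d)) (k₁1 : ∀ d, k₁ d 1 = d)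
    (k₁S : ∀ s t, k₁ (ρ₁ s) t = ρ₁ s)
    (k₂ : C(D₂, C(I, D₂))) (k₂0 : ∀ d, k₂ d 0 = f (g d)) (k₂1 : ∀ d, k₂ d 1 = d)
    (k₂S : ∀ s t, k₂ (ρ₂ s) t = ρ₂ s) :
    ∃ F : B₁ ≃ₕ B₂, (∀ x, F (a₁ x) = a₂ x) ∧ ∀ d, F (χ₁ d) = χ₂ (f d) := by
  obtain ⟨F, Fa, Fχ⟩ := hB₁.desc a₂ (χ₂.comp f) (fun s => by simp [hf, hB₂.comm])
  obtain ⟨G, Ga, Gχ⟩ := hB₂.desc a₁ (χ₁.comp g) (fun s => by simp [hg, hB₁.comm])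
  refine ⟨⟨F, G, ?_, ?_⟩, Fa, Fχ⟩
  · exact hB₁.homotopic_id (G.comp F) (g.comp f) (fun x => by simp [Fa, Ga]) (fun d => by simp [Fχ, Gχ])
      k₁ k₁0 k₁1 k₁S
  · exact hB₂.homotopic_id (F.comp G) (f.comp g) (fun x => by simp [Fa, Ga]) (fun d => by simp [Fχ, Gχ])
      k₂ k₂0 k₂1 k₂S

end Pushout

/-! ### The mapping cylinder and its two ends. -/

section Cylinder

variable {K₁ : Type u} {K₂ : Type v} [TopologicalSpace K₁] [TopologicalSpace K₂]

/-- The end of the cylinder. -/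
def cylEnd (K : Type u) [TopologicalSpace K] : C(K, K × I) := ⟨fun x => (x, 1), by fun_prop⟩

/-- The free end of the mapping cylinder. -/
def cylTop (F : C(K₁, K₂)) : C(K₁, Glue (cylEnd K₁) F) :=
  (Glue.inr (cylEnd K₁) F).comp ⟨fun x => (x, 0), by fun_prop⟩

/-- At time `t` the part of the cylinder above height `t/2` carries `f`, stretched linearly; the
collar below it carries `h`, at time `t` on the free end and time `0` at height `t/2`. -/
theorem hep_cylTop (F : C(K₁, K₂)) : HEP.{_, _, w} (cylTop F) := by
  intro Y _ f h h0
  let pr (r : ℝ) : I := Set.projIcc 0 1 zero_le_one r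
  have hpr : Continuous pr := continuous_projIcc
  have pr0 : ∀ r ≤ 0, pr r = 0 := fun r hr => Set.projIcc_of_le_left _ hr
  have pr1 : ∀ r ≥ 1, pr r = 1 := fun r hr => Set.projIcc_of_right_le _ hr
  have prc : ∀ r : I, pr r = r := fun r => Set.projIcc_val _ r
  have hne : ∀ t : I, (1 : ℝ) - t / 2 ≠ 0 := fun t => by linarith [t.2.2]
  let H : (K₁ × I) × I → Y := fun p =>
    if (p.2 : ℝ) / 2 ≤ p.1.2 then
      f (Glue.inr _ F (p.1.1, pr ((p.1.2 - p.2 / 2) / (1 - p.2 / 2))))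
    else h p.1.1 (pr (p.2 - 2 * p.1.2))
  have hH : Continuous H := by
    refine Continuous.if_le ?_ (by fun_prop) (by fun_prop) (by fun_prop) ?_
    · have : Continuous fun p : (K₁ × I) × I => ((p.1.2 : ℝ) - p.2 / 2) / (1 - p.2 / 2) :=
        Continuous.div (by fun_prop) (by fun_prop) (fun p => hne p.2)
      fun_prop
    · intro p hp
      rw [pr0 _ (by rw [hp]; simp), pr0 (p.2 - 2 * p.1.2) (by linarith), h0]
      rfl
  obtain ⟨k, kl, kr⟩ := (Glue.isGlue (cylEnd K₁) F).desc
    (ContinuousMap.curry ⟨fun p : K₂ × I => f (Glue.inl _ F p.1), by fun_prop⟩)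
    (ContinuousMap.curry ⟨H, hH⟩) (fun x => by
      ext t
      change f (Glue.inl _ F (F x)) = H ((x, 1), t)
      have ht := t.2.2
      simp only [H, Set.Icc.coe_one]
      rw [if_pos (by linarith), (Glue.isGlue (cylEnd K₁) F).comm, div_self (hne t),
        pr1 _ le_rfl]
      rfl)
  refine ⟨k, fun b => ?_, fun x => ?_⟩
  · rcases (Glue.isGlue (cylEnd K₁) F).cases b with ⟨x, rfl⟩ | ⟨⟨x, s⟩, rfl⟩
    · rw [kl]; rfl
    · rw [kr]
      change H ((x, s), 0) = _
      have hs := s.2.1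
      simp only [H, Set.Icc.coe_zero]
      rw [if_pos (by linarith)]
      simp [prc]
  · change k (Glue.inr _ F (x, 0)) = _
    rw [kr]
    ext t
    change H ((x, 0), t) = _
    have ht := t.2.1
    simp only [H, Set.Icc.coe_zero]
    split_ifs with h'
    · have : t = 0 := by ext1; exact le_antisymm (by simp only [Set.Icc.coe_zero]; linarith) ht
      subst this
      rw [h0, pr0 _ (by simp)]
      rfl
    · simp [prc]

/-- Heights are pushed to the glued end by `s ↦ 1 - (1 - s)(1 - t)`. -/
theorem isSDR_cyl_inl (F : C(K₁, K₂)) : IsSDR (Glue.inl (cylEnd K₁) F) := by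
  have hG := Glue.isGlue (cylEnd K₁) F
  obtain ⟨r, ra, rχ⟩ := hG.desc (ContinuousMap.id K₂) (F.comp ⟨Prod.fst, by fun_prop⟩)
    (fun s => rfl)
  obtain ⟨k, ka, kχ⟩ := hG.desc
    (ContinuousMap.curry ⟨fun p : K₂ × I => Glue.inl _ F p.1, by fun_prop⟩)
    (ContinuousMap.curry ⟨fun p : (K₁ × I) × I =>
      Glue.inr (cylEnd K₁) F (p.1.1, unitInterval.symm (unitInterval.symm p.1.2 *
        unitInterval.symm p.2)), by fun_prop⟩)
    (fun s => by
      ext t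
      simp only [ContinuousMap.curry_apply, ContinuousMap.coe_mk]
      rw [hG.comm]
      simp [cylEnd])
  refine ⟨r, k, ra, fun b => ?_, fun b => ?_, fun a t => ?_⟩
  · rcases hG.cases b with ⟨x, rfl⟩ | ⟨⟨x, s⟩, rfl⟩
    · rw [ka]; rfl
    · rw [kχ]; simp
  · rcases hG.cases b with ⟨x, rfl⟩ | ⟨⟨x, s⟩, rfl⟩
    · rw [ka, ra]; rfl
    · rw [kχ, rχ]
      simp only [ContinuousMap.curry_apply, ContinuousMap.coe_mk, ContinuousMap.comp_apply]
      rw [hG.comm]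
      simp [cylEnd]
  · rw [ka]; rfl

theorem cylTop_homotopic (F : C(K₁, K₂)) :
    (cylTop F).Homotopic ((Glue.inl (cylEnd K₁) F).comp F) := by
  refine homotopic_iff.2 ⟨ContinuousMap.curry (Glue.inr (cylEnd K₁) F), fun x => rfl, fun x => ?_⟩
  exact ((Glue.isGlue (cylEnd K₁) F).comm x).symm

/-- The mapping cylinder of a homotopy equivalence deformation retracts to its free end. -/
theorem isSDR_cylTop (F : K₁ ≃ₕ K₂) : IsSDR (cylTop F.toFun) := by
  obtain ⟨r, k, ra, k0, k1, -⟩ := isSDR_cyl_inl F.toFun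
  have hr : (ContinuousMap.id _).Homotopic ((Glue.inl (cylEnd K₁) F.toFun).comp r) :=
    homotopic_iff.2 ⟨k, k0, k1⟩
  have hrl : r.comp (Glue.inl (cylEnd K₁) F.toFun) = ContinuousMap.id _ := by ext x; exact ra x
  have hrt : (r.comp (cylTop F.toFun)).Homotopic F.toFun := by
    have := (ContinuousMap.Homotopic.refl r).comp (cylTop_homotopic F.toFun)
    rwa [← ContinuousMap.comp_assoc, hrl, ContinuousMap.id_comp] at this
  refine (hep_cylTop F.toFun).isSDR (hep_cylTop F.toFun) (F.invFun.comp r) ?_ ?_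
  · exact ((ContinuousMap.Homotopic.refl F.invFun).comp hrt).trans F.left_inv
  · have h1 := (cylTop_homotopic F.toFun).comp (ContinuousMap.Homotopic.refl (F.invFun.comp r))
    have h2 : (((Glue.inl (cylEnd K₁) F.toFun).comp F.toFun).comp (F.invFun.comp r)).Homotopic
        ((Glue.inl (cylEnd K₁) F.toFun).comp r) :=
      (ContinuousMap.Homotopic.refl (Glue.inl (cylEnd K₁) F.toFun)).comp
        (F.right_inv.comp (ContinuousMap.Homotopic.refl r))
    exact (h1.trans h2).trans hr.symm

end Cylinder

/-! ### Dependence of an attached space on the homotopy class of the attaching map. -/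

section Attach

variable {S D N Y : Type*} [TopologicalSpace S] [TopologicalSpace D] [TopologicalSpace N]
  [TopologicalSpace Y] (ρ : C(S, D)) (Φ : C(S, C(I, N)))

/-- The inclusion of the wall of the cylinder on `D`. -/
abbrev wall : C(S × I, D × I) := ρ.prodMap (ContinuousMap.id I)

/-- The space `N` with a cylinder on `D` attached along the homotopy `Φ`. -/
abbrev AttachCyl := Glue (wall ρ) Φ.uncurry

variable {ρ Φ}

/-- Sliding `D × I` down to `D × {0}` makes `u` and `v` equal, along homotopies that agree on `S ×
I`. Made relative to `S × I`, the resulting homotopy extends by the constant one on `N`. -/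
theorem AttachCyl.homotopic_aux {Y : Type w} [TopologicalSpace Y] (hρ : HEP.{_, _, w} ρ)
    (u v : C(AttachCyl ρ Φ, Y))
    (hN : ∀ n, u (Glue.inl _ _ n) = v (Glue.inl _ _ n))
    (hD : ∀ d, u (Glue.inr _ _ (d, 0)) = v (Glue.inr _ _ (d, 0))) : u.Homotopic v := by
  have hG := Glue.isGlue (wall ρ) Φ.uncurry
  let hh (u : C(AttachCyl ρ Φ, Y)) : C(D × I, C(I, Y)) := ContinuousMap.curry
    ⟨fun p : (D × I) × I => u (Glue.inr _ _ (p.1.1, p.1.2 * unitInterval.symm p.2)), by fun_prop⟩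
  have hS : ∀ s t, u (Glue.inr _ _ (ρ s, t)) = v (Glue.inr _ _ (ρ s, t)) := fun s t => by
    have := hG.comm (s, t)
    simp only [ContinuousMap.prodMap_apply, Prod.map, ContinuousMap.id_apply] at this
    rw [← this, hN]
  obtain ⟨k, k0, k1, kS⟩ := hρ.prod_interval.homotopy_rel (hh u) (hh v)
    (fun p => by simp [hh, hD]) (fun p => by ext t; simp [hh, hS])
  obtain ⟨K, Ka, Kχ⟩ := hG.desc
    (ContinuousMap.curry ⟨fun p : N × I => u (Glue.inl _ _ p.1), by fun_prop⟩) k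
    (fun ⟨s, τ⟩ => by
      ext t
      rw [kS]
      simp only [ContinuousMap.curry_apply, ContinuousMap.coe_mk]
      rw [hG.comm]
      simp [hh])
  refine homotopic_iff.2 ⟨K, fun b => ?_, fun b => ?_⟩
  · rcases hG.cases b with ⟨x, rfl⟩ | ⟨d, rfl⟩
    · rw [Ka]; rfl
    · rw [Kχ, k0]; simp [hh]
  · rcases hG.cases b with ⟨x, rfl⟩ | ⟨d, rfl⟩
    · rw [Ka, ← hN]; rfl
    · rw [Kχ, k1]; simp [hh]

/-- Two maps are homotopic if they are homotopic on `N ∪ D × {0}`. -/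
theorem AttachCyl.homotopic {Y : Type w} [TopologicalSpace Y] (hρ : HEP.{_, _, w} ρ)
    (u v : C(AttachCyl ρ Φ, Y)) (Γ : C(N, C(I, Y))) (Δ : C(D, C(I, Y)))
    (Γ0 : ∀ n, Γ n 0 = u (Glue.inl _ _ n)) (Γ1 : ∀ n, Γ n 1 = v (Glue.inl _ _ n))
    (Δ0 : ∀ d, Δ d 0 = u (Glue.inr _ _ (d, 0))) (Δ1 : ∀ d, Δ d 1 = v (Glue.inr _ _ (d, 0)))
    (hΔ : ∀ s, Δ (ρ s) = Γ (Φ s 0)) : u.Homotopic v := by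
  have hG := Glue.isGlue (wall ρ) Φ.uncurry
  -- The homotopy on `D × {0}` is spread over `D × I` compatibly with `Γ` on the wall. Its ends
  -- match `u` and `v` only on `N ∪ D × {0}`, which `AttachCyl.homotopic_aux` repairs.
  obtain ⟨W, W0, WS⟩ := hρ C(I, Y) Δ (ContinuousMap.curry
    ⟨fun p : S × I => Γ (Φ p.1 p.2), by fun_prop⟩) (fun s => by simp [hΔ])
  obtain ⟨K, Ka, Kχ⟩ := hG.desc Γ W.uncurry (fun ⟨s, τ⟩ => by simp [WS])
  have h : ContinuousMap.Homotopic (⟨fun b => K b 0, by fun_prop⟩ : C(AttachCyl ρ Φ, Y))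
      ⟨fun b => K b 1, by fun_prop⟩ := homotopic_iff.2 ⟨K, fun _ => rfl, fun _ => rfl⟩
  refine ((AttachCyl.homotopic_aux hρ u _ (fun n => ?_) (fun d => ?_)).trans h).trans
    (AttachCyl.homotopic_aux hρ _ v (fun n => ?_) (fun d => ?_))
  · simp [Ka, Γ0]
  · simp [Kχ, W0, Δ0]
  · simp [Ka, Γ1]
  · simp [Kχ, W0, Δ1]

/-- Attaching the cylinder on `D` instead of `D` itself, along a homotopy in a larger space `N` that
deformation retracts to `K`, does not change the homotopy type. -/
theorem IsGlue.homotopyEquiv_attachCyl {S K : Type*} {N : Type w} {D : Type u} {L : Type v}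
    [TopologicalSpace S] [TopologicalSpace D] [TopologicalSpace K] [TopologicalSpace L] [TopologicalSpace N]
    {ρ : C(S, D)} {φ : C(S, K)} {a : C(K, L)} {χ : C(D, L)} (hL : IsGlue ρ φ a χ)
    (hρ : HEP.{_, _, v} ρ) {j : C(K, N)} (hj : IsSDR j) {Φ : C(S, C(I, N))}
    (hρ' : HEP.{_, _, max w u} ρ) (hΦ : ∀ s, Φ s 0 = j (φ s)) :
    Nonempty (L ≃ₕ AttachCyl ρ Φ) := by
  obtain ⟨r, G, rj, G0, G1, Gj⟩ := hj
  have hG := Glue.isGlue (wall ρ) Φ.uncurry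
  obtain ⟨i, ia, iχ⟩ := hL.desc ((Glue.inl (wall ρ) Φ.uncurry).comp j)
    ((Glue.inr (wall ρ) Φ.uncurry).comp ⟨fun d => (d, 0), by fun_prop⟩) (fun s => by
      have := hG.comm (s, 0)
      simp only [ContinuousMap.uncurry_apply, Function.uncurry_apply_pair, hΦ] at this
      simpa using this)
  -- The homotopy inverse: `N` retracts to `K`, and over `D × I` the map `χ` is extended along the
  -- retracted homotopy `Φ`.
  obtain ⟨H, H0, HS⟩ := hρ L χ (ContinuousMap.curry
    ⟨fun p : S × I => a (r (Φ p.1 p.2)), by fun_prop⟩) (fun s => by simp [hΦ, rj, hL.comm])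
  obtain ⟨q, qa, qχ⟩ := hG.desc (a.comp r) H.uncurry (fun ⟨s, τ⟩ => by simp [HS])
  refine ⟨⟨i, q, ?_, ?_⟩⟩
  · have : q.comp i = ContinuousMap.id L := hL.hom_ext (fun x => by simp [ia, qa, rj])
      (fun d => by simp [iχ, qχ, H0])
    rw [this]
  -- The retraction homotopy on `N` and the constant one on `D × {0}` fit together because the
  -- former fixes the image of `K`.
  · refine (AttachCyl.homotopic hρ' (ContinuousMap.id _) (i.comp q)
      (ContinuousMap.curry ⟨fun p : N × I => Glue.inl _ _ (G p.1 p.2), by fun_prop⟩)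
      (ContinuousMap.curry ⟨fun p : D × I => Glue.inr _ _ (p.1, 0), by fun_prop⟩)
      ?_ ?_ ?_ ?_ ?_).symm
    · intro n; simp [G0]
    · intro n; simp [G1, qa, ia]
    · intro d; simp
    · intro d; simp [qχ, H0, iχ]
    · intro s
      ext t
      have := hG.comm (s, 0)
      simp only [ContinuousMap.uncurry_apply, Function.uncurry_apply_pair, hΦ] at this
      simpa [hΦ, Gj] using this.symm

/-- The reversed homotopy. -/
def revHomotopy (Φ : C(S, C(I, N))) : C(S, C(I, N)) :=
  ContinuousMap.curry ⟨fun p : S × I => Φ p.1 (unitInterval.symm p.2), by fun_prop⟩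

theorem AttachCyl.homotopyEquiv_rev (ρ : C(S, D)) (Φ : C(S, C(I, N))) :
    Nonempty (AttachCyl ρ Φ ≃ₕ AttachCyl ρ (revHomotopy Φ)) := by
  have hG := Glue.isGlue (wall ρ) Φ.uncurry
  have hG' := Glue.isGlue (wall ρ) (revHomotopy Φ).uncurry
  let m : C(D × I, D × I) := ⟨fun p => (p.1, unitInterval.symm p.2), by fun_prop⟩
  obtain ⟨f, fa, fχ⟩ := hG.desc (Glue.inl (wall ρ) (revHomotopy Φ).uncurry)
    ((Glue.inr _ _).comp m) (fun ⟨s, τ⟩ => by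
      have := hG'.comm (s, unitInterval.symm τ)
      simp [revHomotopy] at this ⊢
      exact this)
  obtain ⟨g, ga, gχ⟩ := hG'.desc (Glue.inl (wall ρ) Φ.uncurry)
    ((Glue.inr _ _).comp m) (fun ⟨s, τ⟩ => by
      have := hG.comm (s, unitInterval.symm τ)
      simpa [revHomotopy, m] using this)
  refine ⟨⟨f, g, ?_, ?_⟩⟩
  · rw [hG.hom_ext (f := g.comp f) (g := ContinuousMap.id _) (fun x => by simp [fa, ga])
      (fun d => by simp [fχ, gχ, m])]
  · rw [hG'.hom_ext (f := f.comp g) (g := ContinuousMap.id _) (fun x => by simp [fa, ga])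
      (fun d => by simp [fχ, gχ, m])]

/-- Attaching `D` to homotopy equivalent spaces along homotopic maps gives homotopy equivalent
spaces. -/
theorem IsGlue.homotopyEquiv_of_homotopic {S : Type*} {K₁ : Type x} {K₂ : Type y}
    {D : Type u} {L₁ : Type v} {L₂ : Type w}
    [TopologicalSpace S] [TopologicalSpace D] [TopologicalSpace K₁] [TopologicalSpace K₂]
    [TopologicalSpace L₁] [TopologicalSpace L₂] {ρ : C(S, D)} {φ₁ : C(S, K₁)} {φ₂ : C(S, K₂)}
    {a₁ : C(K₁, L₁)} {a₂ : C(K₂, L₂)} {χ₁ : C(D, L₁)} {χ₂ : C(D, L₂)}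
    (hL₁ : IsGlue ρ φ₁ a₁ χ₁) (hL₂ : IsGlue ρ φ₂ a₂ χ₂) (hρ₁ : HEP.{_, _, v} ρ)
    (hρ₂ : HEP.{_, _, w} ρ) (hρ : HEP.{_, _, max x y u} ρ) (F : K₁ ≃ₕ K₂)
    (hF : (F.toFun.comp φ₁).Homotopic φ₂) : Nonempty (L₁ ≃ₕ L₂) := by
  -- Inside the mapping cylinder the two attaching maps become homotopic. Both spaces are then
  -- compared with `D × I` attached along this homotopy, read from its start or from its end.
  have h : ((cylTop F.toFun).comp φ₁).Homotopic ((Glue.inl (cylEnd K₁) F.toFun).comp φ₂) :=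
    ((cylTop_homotopic F.toFun).comp (ContinuousMap.Homotopic.refl φ₁)).trans
      ((ContinuousMap.Homotopic.refl (Glue.inl (cylEnd K₁) F.toFun)).comp hF)
  obtain ⟨Φ, Φ0, Φ1⟩ := homotopic_iff.1 h
  obtain ⟨e₁⟩ := hL₁.homotopyEquiv_attachCyl hρ₁ (isSDR_cylTop F) (Φ := Φ) hρ Φ0
  obtain ⟨e₂⟩ := hL₂.homotopyEquiv_attachCyl hρ₂ (isSDR_cyl_inl F.toFun) (Φ := revHomotopy Φ) hρ
    (fun s => by simpa [revHomotopy] using Φ1 s)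
  obtain ⟨e⟩ := AttachCyl.homotopyEquiv_rev ρ Φ
  exact ⟨(e₁.trans e).trans e₂.symm⟩

end Attach

/-! ### Attaching cells and pairs of subcomplexes in a CW complex. -/

/-- Inclusions of subspaces. -/
def incl {L : Type*} [TopologicalSpace L] {A B : Set L} (h : A ⊆ B) : C(A, B) :=
  ⟨Set.inclusion h, continuous_inclusion h⟩

/-- The inclusion of the boundaries of a family of cubes. -/
def sphereIncls (ι : Type*) (n : ℕ) :
    C(Σ _ : ι, sphere (0 : Fin n → ℝ) 1, Σ _ : ι, closedBall (0 : Fin n → ℝ) 1) :=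
  ⟨fun p => ⟨p.1, sphereIncl n p.2⟩,
    continuous_sigma fun _ => continuous_sigmaMk.comp (sphereIncl n).continuous⟩

theorem hep_sphereIncls (ι : Type*) (n : ℕ) : HEP.{_, _, w} (sphereIncls ι n) :=
  HEP.sigma (fun _ => sphereIncl n) (fun _ => hep_sphereIncl n) _ fun _ _ => rfl

theorem mem_range_sphereIncls {ι : Type*} {n : ℕ} (d : Σ _ : ι, closedBall (0 : Fin n → ℝ) 1)
    (hd : (d.2 : Fin n → ℝ) ∉ ball 0 1) : d ∈ Set.range (sphereIncls ι n) := by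
  obtain ⟨i, v, hv⟩ := d
  have : v ∈ sphere (0 : Fin n → ℝ) 1 := by
    rw [← closedBall_sdiff_ball]; exact ⟨hv, hd⟩
  exact ⟨⟨i, v, this⟩, rfl⟩

/-- To glue compact pieces to a closed subspace of a Hausdorff space. -/
theorem isQuotientMap_sumElim {A B D : Type*} [TopologicalSpace A] [TopologicalSpace B]
    [TopologicalSpace D] [T2Space B] [CompactSpace D] {a : C(A, B)} (ha : IsClosedMap a)
    (χ : C(D, B)) (hs : ∀ b, (∃ x, a x = b) ∨ ∃ d, χ d = b) : IsQuotientMap (Sum.elim a χ) := by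
  have hc : IsClosedMap (Sum.elim a χ) := isClosedMap_sumElim.2 ⟨ha, χ.continuous.isClosedMap⟩
  refine hc.isQuotientMap (by fun_prop) fun b => ?_
  rcases hs b with ⟨x, rfl⟩ | ⟨d, rfl⟩
  exacts [⟨Sum.inl x, rfl⟩, ⟨Sum.inr d, rfl⟩]

section CW

open RelCWComplex

variable {L : Type u} [TopologicalSpace L] [CWComplex (Set.univ : Set L)] {n : ℕ} {ι : Type*}
  (c : ι → cell (Set.univ : Set L) n) {A B : Set L}

/-- The characteristic maps of a family of cells. -/
def cellMaps (h : ∀ i, closedCell n (c i) ⊆ B) : C(Σ _ : ι, closedBall (0 : Fin n → ℝ) 1, B) :=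
  ⟨fun p => ⟨map n (c p.1) p.2, h p.1 ⟨_, p.2.2, rfl⟩⟩, continuous_sigma fun i =>
    Continuous.subtype_mk (continuousOn_iff_continuous_domRestrict.1 (continuousOn n (c i))) _⟩

/-- The attaching maps of a family of cells. -/
def attachMaps (h : ∀ i, cellFrontier n (c i) ⊆ A) : C(Σ _ : ι, sphere (0 : Fin n → ℝ) 1, A) :=
  ⟨fun p => ⟨map n (c p.1) p.2, h p.1 ⟨_, p.2.2, rfl⟩⟩, continuous_sigma fun i =>
    Continuous.subtype_mk (continuousOn_iff_continuous_domRestrict.1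
      ((continuousOn n (c i)).mono sphere_subset_closedBall)) _⟩

/-- A subspace obtained from a closed subspace by attaching finitely many cells. -/
theorem isGlue_cells [T2Space L] [Finite ι] (hc : Function.Injective c) (hA : IsClosed A)
    (hAB : A ⊆ B) (hB : ∀ i, closedCell n (c i) ⊆ B) (hfr : ∀ i, cellFrontier n (c i) ⊆ A)
    (hdisj : ∀ i, Disjoint (openCell n (c i)) A)
    (hsurj : ∀ p ∈ B, p ∈ A ∨ ∃ i, p ∈ closedCell n (c i)) :
    IsGlue (sphereIncls ι n) (attachMaps c hfr) (incl hAB) (cellMaps c hB) := by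
  have := Fintype.ofFinite ι
  have hemb : IsClosedMap (incl hAB) :=
    (Topology.IsClosedEmbedding.inclusion hAB (hA.preimage continuous_subtype_val)).isClosedMap
  have hopen : ∀ d : Σ _ : ι, closedBall (0 : Fin n → ℝ) 1, (d.2 : Fin n → ℝ) ∈ ball 0 1 →
      (cellMaps c hB d : L) ∈ openCell n (c d.1) := fun d hd => ⟨_, hd, rfl⟩
  have hfrr : ∀ d : Σ _ : ι, closedBall (0 : Fin n → ℝ) 1, (d.2 : Fin n → ℝ) ∉ ball 0 1 →
      (cellMaps c hB d : L) ∈ A := fun d hd => hfr d.1 ⟨d.2, by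
        rw [← closedBall_sdiff_ball]; exact ⟨d.2.2, hd⟩, rfl⟩
  refine IsGlue.of_injective (fun s => rfl) (isQuotientMap_sumElim hemb _ ?_)
    (Set.inclusion_injective hAB) ?_ ?_
  · rintro ⟨p, hp⟩
    rcases hsurj p hp with h | ⟨i, v, hv, h⟩
    · exact Or.inl ⟨⟨p, h⟩, rfl⟩
    · exact Or.inr ⟨⟨i, v, hv⟩, Subtype.ext h⟩
  · intro d x h
    by_contra hd
    have hd' : (d.2 : Fin n → ℝ) ∈ ball 0 1 := by
      by_contra h'; exact hd (mem_range_sphereIncls d h')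
    have h1 := hopen d hd'
    rw [h] at h1
    exact Set.disjoint_left.1 (hdisj d.1) h1 x.2
  · intro d d' h
    by_cases hd : (d.2 : Fin n → ℝ) ∈ ball 0 1 <;> by_cases hd' : (d'.2 : Fin n → ℝ) ∈ ball 0 1
    · left
      have h1 := hopen d hd
      have h2 := hopen d' hd'
      obtain ⟨i, v, hv⟩ := d
      obtain ⟨i', v', hv'⟩ := d'
      rw [← h] at h2
      have hi : c i = c i' := by
        by_contra hne
        exact Set.disjoint_left.1 (disjoint_openCell_of_ne (by simpa using hne)) h1 h2
      obtain rfl := hc hi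
      have hinj : Set.InjOn (map n (c i)) (ball 0 1) := by
        rw [← source_eq n (c i)]; exact (map n (c i)).injOn
      obtain rfl : v = v' := hinj hd hd' (congrArg Subtype.val h)
      rfl
    · have h1 := hopen d hd
      rw [h] at h1
      exact absurd (hfrr d' hd') (Set.disjoint_left.1 (hdisj d.1) h1)
    · have h1 := hopen d' hd'
      rw [← h] at h1
      exact absurd (hfrr d hd) (Set.disjoint_left.1 (hdisj d'.1) h1)
    · exact Or.inr ⟨mem_range_sphereIncls d hd, mem_range_sphereIncls d' hd'⟩

/-- A union of open cells that contains the closures of its cells. -/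
def IsCellular (E : Set L) : Prop :=
  ∀ p ∈ E, ∃ (n : ℕ) (c : cell (Set.univ : Set L) n), p ∈ openCell n c ∧ closedCell n c ⊆ E

theorem eq_of_mem_openCell {n m : ℕ} {c : cell (Set.univ : Set L) n}
    {d : cell (Set.univ : Set L) m} {p : L} (hc : p ∈ openCell n c) (hd : p ∈ openCell m d) :
    (⟨n, c⟩ : Σ n, cell (Set.univ : Set L) n) = ⟨m, d⟩ := by
  by_contra h
  exact Set.disjoint_left.1 (disjoint_openCell_of_ne h) hc hd

theorem IsCellular.closedCell_subset {E : Set L} (hE : IsCellular E) {n : ℕ}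
    {c : cell (Set.univ : Set L) n} {p : L} (hp : p ∈ openCell n c) (hpE : p ∈ E) :
    closedCell n c ⊆ E := by
  obtain ⟨m, d, hd, h⟩ := hE p hpE
  obtain ⟨rfl, rfl⟩ := Sigma.mk.inj_iff.1 (eq_of_mem_openCell hp hd)
  exact h

theorem exists_mem_openCell (p : L) :
    ∃ (n : ℕ) (c : cell (Set.univ : Set L) n), p ∈ openCell n c := by
  have := CWComplex.iUnion_openCell_eq_complex (C := (Set.univ : Set L))
  simpa using this.ge (Set.mem_univ p)

theorem isCellular_skeletonLT [T2Space L] (N : ℕ∞) :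
    IsCellular (skeletonLT (Set.univ : Set L) N : Set L) := by
  intro p hp
  obtain ⟨m, hm, c, hc⟩ := CWComplex.mem_skeletonLT_iff.1 hp
  refine ⟨m, c, hc, (closedCell_subset_skeletonLT m c).trans (skeletonLT_mono ?_)⟩
  exact Order.add_one_le_of_lt hm

theorem hep_incl_refl {L : Type*} [TopologicalSpace L] (A : Set L) :
    HEP.{_, _, w} (incl (subset_refl A)) := HEP.homeomorph (Homeomorph.refl A)

/-- The homotopy extension property of a pair of subcomplexes. -/
theorem hep_incl_of_isCellular [T2Space L] [∀ n, Finite (cell (Set.univ : Set L) n)]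
    {A B : Set L} (hAB : A ⊆ B) (hA : IsClosed A) (hB : IsClosed B) (hA' : IsCellular A)
    (hB' : IsCellular B) (N : ℕ) (hN : ∀ n, N ≤ n → IsEmpty (cell (Set.univ : Set L) n)) :
    HEP.{_, _, w} (incl hAB) := by
  -- `skeletonLT` at `n` has the cells of dimension less than `n`, so the filtration starts at `A`,
  -- and step `n` attaches the `n`-cells of `B` that are not in `A`.
  let E (n : ℕ) : Set L := A ∪ B ∩ (skeletonLT (Set.univ : Set L) n : Set L)
  have hE : ∀ n, IsClosed (E n) := fun n =>
    hA.union (hB.inter (skeletonLT (Set.univ : Set L) n).closed)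
  have hmono : ∀ n, E n ⊆ E (n + 1) := fun n => Set.union_subset_union_right _
    (Set.inter_subset_inter_right _ (skeletonLT_mono (by exact_mod_cast Nat.le_succ n)))
  have hAE : ∀ n, A ⊆ E n := fun n => Set.subset_union_left
  have step : ∀ n, HEP.{_, _, w} (incl (hmono n)) := by
    intro n
    let c : {c : cell (Set.univ : Set L) n // closedCell n c ⊆ B ∧ ¬ closedCell n c ⊆ A} →
      cell (Set.univ : Set L) n := Subtype.val
    have hcc : ∀ i, closedCell n (c i) ⊆ E (n + 1) := fun i =>
      (Set.subset_inter i.2.1 (closedCell_subset_skeletonLT n i.1)).trans Set.subset_union_right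
    have hfr : ∀ i, cellFrontier n (c i) ⊆ E n := fun i =>
      (Set.subset_inter ((cellFrontier_subset_closedCell n _).trans i.2.1)
        (cellFrontier_subset_skeletonLT n i.1)).trans Set.subset_union_right
    refine (isGlue_cells c Subtype.val_injective (hE n) (hmono n) hcc hfr ?_ ?_).hep
      (hep_sphereIncls _ n)
    · intro i
      rw [Set.disjoint_left]
      rintro p hp (h | ⟨-, h⟩)
      · exact i.2.2 (hA'.closedCell_subset hp h)
      · exact Set.disjoint_right.1 (disjoint_skeletonLT_openCell le_rfl) hp h
    · rintro p (h | ⟨hpB, h⟩)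
      · exact Or.inl (hAE n h)
      · obtain ⟨m, d, hd, hdB⟩ := hB' p hpB
        have hm : m < n + 1 := by
          by_contra hm
          exact Set.disjoint_right.1 (disjoint_skeletonLT_openCell
            (by exact_mod_cast not_lt.1 hm)) hd h
        rcases Nat.lt_succ_iff_lt_or_eq.1 hm with hm | rfl
        · exact Or.inl (Or.inr ⟨hpB, skeletonLT_mono (by exact_mod_cast hm)
            (openCell_subset_skeletonLT m d hd)⟩)
        · by_cases hdA : closedCell m d ⊆ A
          · exact Or.inl (hAE _ (hdA (openCell_subset_closedCell _ _ hd)))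
          · exact Or.inr ⟨⟨d, hdB, hdA⟩, openCell_subset_closedCell _ _ hd⟩
  have all : ∀ n, HEP.{_, _, w} (incl (hAE n)) := by
    intro n
    induction n with
    | zero =>
      have h0 : A = E 0 := by
        simp [E, CWComplex.skeletonLT_zero_eq_empty]
      -- Generalizing the endpoint permits substitution along an equality of sets.
      have : ∀ {A' : Set L} (h : A = A'), HEP.{_, _, w} (incl h.subset) := by
        rintro _ rfl; exact hep_incl_refl A
      exact this h0
    | succ n ih => exact (step n).comp ih
  have hEN : E N = B := by
    refine subset_antisymm (Set.union_subset hAB Set.inter_subset_left) fun p hp => ?_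
    obtain ⟨m, d, hd⟩ := exists_mem_openCell p
    have hm : m < N := by
      by_contra hm
      exact (hN m (not_lt.1 hm)).false d
    exact Or.inr ⟨hp, skeletonLT_mono (by exact_mod_cast hm) (openCell_subset_skeletonLT m d hd)⟩
  have : ∀ {B' : Set L} (h : E N = B') (h' : A ⊆ B'), HEP.{_, _, w} (incl h') := by
    rintro _ rfl h'; exact all N
  exact this hEN hAB

end CW

/-! ### Common cells and the subcomplexes `T̄_z` of one realization. -/

section Realization

open RelCWComplex

variable {X Q Z : Type*} [Fintype Q] {C : CSSCode X Q Z} {ℓ : ZLift C}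

variable (ℓ) in
/-- The cells that all the cellular realizations have in common, apart from the `5`-cells. -/
inductive CoreCell
  | vert (v : X ⊕ Q)
  | edge (e : ℓ.Edge)
  | sph (x : X)
  | qubit (q : Q)

instance [Fintype X] : Finite (CoreCell ℓ) := by
  refine Finite.of_surjective (α := (X ⊕ Q) ⊕ ℓ.Edge ⊕ X ⊕ Q)
    (Sum.elim CoreCell.vert (Sum.elim CoreCell.edge (Sum.elim CoreCell.sph CoreCell.qubit))) ?_
  rintro (v | e | x | q)
  exacts [⟨Sum.inl v, rfl⟩, ⟨Sum.inr (Sum.inl e), rfl⟩, ⟨Sum.inr (Sum.inr (Sum.inl x)), rfl⟩,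
    ⟨Sum.inr (Sum.inr (Sum.inr q)), rfl⟩]

def CoreCell.dim : CoreCell ℓ → ℕ
  | .vert _ => 0
  | .edge _ => 1
  | .sph _ => 3
  | .qubit _ => 4

/-- The cells of the subgraph `T_z`. -/
def CoreCell.InGraph (z : Z) : CoreCell ℓ → Prop
  | .vert (Sum.inr q) => ℓ.HZ z q ≠ 0
  | .vert (Sum.inl x) => ∃ q, ℓ.HZ z q ≠ 0 ∧ ℓ.HX x q ≠ 0
  | .edge e => ℓ.HZ z e.1 ≠ 0
  | _ => False

namespace CellLabelling

variable {L : Type*} [TopologicalSpace L] [CWComplex (Set.univ : Set L)] (K : CellLabelling ℓ L)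

def coreCell : (c : CoreCell ℓ) → cell (Set.univ : Set L) c.dim
  | .vert v => K.cell0 v
  | .edge e => K.cell1 (Sum.inl e)
  | .sph x => K.cell3 x
  | .qubit q => K.cell4 q

/-- The characteristic maps of the common cells. -/
def coreMap (c : CoreCell ℓ) (v : Fin c.dim → ℝ) : L :=
  map (C := Set.univ) c.dim (K.coreCell c) v

theorem coreCell_injective {c d : CoreCell ℓ}
    (h : (⟨c.dim, K.coreCell c⟩ : Σ n, cell (Set.univ : Set L) n) = ⟨d.dim, K.coreCell d⟩) :
    c = d := by
  rcases c with v | e | x | q <;> rcases d with v' | e' | x' | q' <;>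
    simp_all [CoreCell.dim, coreCell]

theorem coreMap_injective {c d : CoreCell ℓ} {v : Fin c.dim → ℝ} {w : Fin d.dim → ℝ}
    (hv : v ∈ ball 0 1) (hw : w ∈ ball 0 1) (h : K.coreMap c v = K.coreMap d w) :
    (⟨c, v⟩ : Σ c : CoreCell ℓ, Fin c.dim → ℝ) = ⟨d, w⟩ := by
  have h1 : K.coreMap c v ∈ openCell c.dim (K.coreCell c) := ⟨v, hv, rfl⟩
  have h2 : K.coreMap c v ∈ openCell d.dim (K.coreCell d) := ⟨w, hw, h.symm⟩
  obtain rfl := K.coreCell_injective (eq_of_mem_openCell h1 h2)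
  have hinj : Set.InjOn (map c.dim (K.coreCell c)) (ball 0 1) := by
    rw [← source_eq c.dim (K.coreCell c)]; exact (map c.dim (K.coreCell c)).injOn
  obtain rfl := hinj hv hw h
  rfl

/-- The points of the common cells. -/
abbrev _root_.CSSCell.CorePoint (ℓ : ZLift C) : Type _ :=
  Σ c : CoreCell ℓ, closedBall (0 : Fin c.dim → ℝ) 1

def corePt : C(CorePoint ℓ, L) :=
  ⟨fun p => K.coreMap p.1 p.2, continuous_sigma fun c =>
    continuousOn_iff_continuous_domRestrict.1 (continuousOn c.dim (K.coreCell c))⟩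

/-- The union of the common cells. -/
def core : Set L := Set.range K.corePt

theorem coreMap_mem_core (c : CoreCell ℓ) {v : Fin c.dim → ℝ} (hv : v ∈ closedBall 0 1) :
    K.coreMap c v ∈ K.core := ⟨⟨c, v, hv⟩, rfl⟩

theorem isClosed_core [Fintype X] [T2Space L] : IsClosed K.core := by
  have := Fintype.ofFinite (CoreCell ℓ)
  exact (isCompact_range K.corePt.continuous).isClosed

/-- The condition on the cell label `c` depends only on the lift, so this form of membership in
`T_z` transfers between realizations. -/
theorem mem_inducedGraph {z : Z} {p : L} : p ∈ K.inducedGraph z ↔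
    ∃ (c : CoreCell ℓ) (v : Fin c.dim → ℝ), c.InGraph z ∧ v ∈ closedBall 0 1 ∧
      p = K.coreMap c v := by
  constructor
  · rintro ((⟨q, hq, rfl⟩ | ⟨x, q, hq, hx, rfl⟩) | h)
    · exact ⟨.vert (Sum.inr q), 0, hq, by simp, rfl⟩
    · exact ⟨.vert (Sum.inl x), 0, ⟨q, hq, hx⟩, by simp, rfl⟩
    · simp only [Set.mem_iUnion] at h
      obtain ⟨e, he, v, hv, rfl⟩ := h
      exact ⟨.edge e, v, he, hv, rfl⟩
  · rintro ⟨c, v, hc, hv, rfl⟩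
    rcases c with (x | q) | e | x | q
    · obtain ⟨q, hq, hx⟩ := hc
      have : v = 0 := Subsingleton.elim (α := Fin 0 → ℝ) _ _
      subst this
      exact Or.inl (Or.inr ⟨x, q, hq, hx, rfl⟩)
    · have : v = 0 := Subsingleton.elim (α := Fin 0 → ℝ) _ _
      subst this
      exact Or.inl (Or.inl ⟨q, hc, rfl⟩)
    · refine Or.inr ?_
      simp only [Set.mem_iUnion]
      exact ⟨e, hc, v, hv, rfl⟩
    · exact hc.elim
    · exact hc.elim

theorem inducedGraph_subset_core (z : Z) : K.inducedGraph z ⊆ K.core := by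
  intro p hp
  obtain ⟨c, v, -, hv, rfl⟩ := K.mem_inducedGraph.1 hp
  exact K.coreMap_mem_core c hv

theorem inducedGraph_subset_Tbar (z : Z) : K.inducedGraph z ⊆ K.Tbar z :=
  Set.subset_union_left.trans Set.subset_union_left

theorem isClosed_inducedGraph [Fintype X] [T2Space L] (z : Z) : IsClosed (K.inducedGraph z) := by
  refine IsClosed.union (Set.Finite.isClosed ?_) ?_
  · refine (Set.finite_range K.vert).subset ?_
    rintro p (⟨q, -, rfl⟩ | ⟨x, q, -, -, rfl⟩) <;> exact Set.mem_range_self _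
  · exact isClosed_iUnion_of_finite fun e => isClosed_iUnion_of_finite fun _ => isClosed_closedCell

theorem isClosed_Tbar [Fintype X] [T2Space L] (z : Z) : IsClosed (K.Tbar z) :=
  ((K.isClosed_inducedGraph z).union (isClosed_iUnion_of_finite fun _ => isClosed_closedCell)).union
    (isClosed_iUnion_of_finite fun _ => isClosed_closedCell)

theorem finite_cell [Fintype X] [Finite Z] (K : CellLabelling ℓ L) (n : ℕ) : Finite (cell (Set.univ : Set L) n) := by
  match n with
  | 0 => exact Finite.of_equiv _ K.cell0
  | 1 => exact Finite.of_equiv _ K.cell1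
  | 2 => exact Finite.of_equiv _ K.cell2
  | 3 => exact Finite.of_equiv _ K.cell3
  | 4 => exact Finite.of_equiv _ K.cell4
  | 5 => exact Finite.of_equiv _ K.cell5
  | n + 6 =>
    have := K.cell_isEmpty (n + 6) (by omega)
    infer_instance

end CellLabelling

namespace CellularRealization

variable [Fintype X] {G : ∀ z : Z, CheckGluing ℓ z}

section Single

variable {L : Type*} [TopologicalSpace L] [CWComplex (Set.univ : Set L)]
  (R : CellularRealization ℓ G L)

theorem edge_endpoint {z : Z} {e : ℓ.Edge} (he : ℓ.HZ z e.1 ≠ 0) {p : L}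
    (hp : p ∈ cellFrontier 1 (R.cell1 (Sum.inl e))) : p ∈ R.inducedVertices z := by
  obtain ⟨q, e⟩ := e
  rw [cellFrontier_one_eq] at hp
  rcases hp with ⟨_, rfl | rfl, rfl⟩
  · have h' : ℓ.HX e.1 q ≠ 0 := by
      -- An edge at `x` is an element of `Fin |HX x q|`, which forces the entry to be nonzero.
      have := e.2.pos
      omega
    exact Or.inr ⟨e.1, q, he, h', R.edge_x q e⟩
  · exact Or.inl ⟨q, he, R.edge_q q e⟩

theorem zEdge_endpoint {z : Z} {i : Fin (R.numEdges z)} {p : L}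
    (hp : p ∈ cellFrontier 1 (R.cell1 (Sum.inr ⟨z, i⟩))) : p ∈ R.inducedVertices z := by
  rw [cellFrontier_one_eq] at hp
  rcases hp with ⟨_, rfl | rfl, rfl⟩
  exacts [R.zEdge_left z i, R.zEdge_right z i]

theorem isCellular_inducedGraph (z : Z) : IsCellular (R.inducedGraph z) := by
  have hv : ∀ p ∈ R.inducedVertices z, ∃ (n : ℕ) (c : cell (Set.univ : Set L) n),
      p ∈ openCell n c ∧ closedCell n c ⊆ R.inducedGraph z := by
    intro p hp
    have : ∃ v, p = R.vert v := by
      rcases hp with (⟨q, hq, rfl⟩ | ⟨x, q, hq, hx, rfl⟩) <;> exact ⟨_, rfl⟩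
    obtain ⟨v, rfl⟩ := this
    refine ⟨0, R.cell0 v, map_zero_mem_openCell _ _, ?_⟩
    rintro _ ⟨u, -, rfl⟩
    obtain rfl : u = 0 := Subsingleton.elim _ _
    exact Or.inl hp
  rintro p (hp | hp)
  · exact hv p hp
  · simp only [Set.mem_iUnion] at hp
    obtain ⟨e, he, hp⟩ := hp
    rw [← cellFrontier_union_openCell_eq_closedCell] at hp
    rcases hp with hp | hp
    · exact hv p (R.edge_endpoint he hp)
    · refine ⟨1, _, hp, fun y hy => Or.inr ?_⟩
      simp only [Set.mem_iUnion]
      exact ⟨e, he, hy⟩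

/-- The cells of `T̄_z` outside of the graph `T_z`. -/
theorem mem_Tbar_cases {z : Z} {p : L} (hp : p ∈ R.Tbar z) : p ∈ R.inducedGraph z ∨
    (∃ i, p ∈ openCell 1 (R.cell1 (Sum.inr ⟨z, i⟩))) ∨ ∃ i, p ∈ openCell 2 (R.cell2 ⟨z, i⟩) := by
  have h1 : p ∈ R.dressedGraph z → p ∈ R.inducedGraph z ∨
      (∃ i, p ∈ openCell 1 (R.cell1 (Sum.inr ⟨z, i⟩))) := by
    rintro (hp | hp)
    · exact Or.inl hp
    · obtain ⟨i, hp⟩ := Set.mem_iUnion.1 hp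
      rw [← cellFrontier_union_openCell_eq_closedCell] at hp
      rcases hp with hp | hp
      · exact Or.inl (Or.inl (R.zEdge_endpoint hp))
      · exact Or.inr ⟨i, hp⟩
  rcases hp with hp | hp
  · exact (h1 hp).imp_right Or.inl
  · obtain ⟨i, hp⟩ := Set.mem_iUnion.1 hp
    rw [← cellFrontier_union_openCell_eq_closedCell] at hp
    rcases hp with hp | hp
    · exact (h1 (R.face_frontier z i hp)).imp_right Or.inl
    · exact Or.inr (Or.inr ⟨i, hp⟩)

theorem isCellular_Tbar (z : Z) : IsCellular (R.Tbar z) := by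
  intro p hp
  rcases R.mem_Tbar_cases hp with hp | ⟨i, hp⟩ | ⟨i, hp⟩
  · obtain ⟨n, c, hc, h⟩ := R.isCellular_inducedGraph z p hp
    exact ⟨n, c, hc, h.trans (R.inducedGraph_subset_Tbar z)⟩
  · exact ⟨1, _, hp, fun y hy => Or.inl (Or.inr (Set.mem_iUnion.2 ⟨i, hy⟩))⟩
  · exact ⟨2, _, hp, fun y hy => Or.inr (Set.mem_iUnion.2 ⟨i, hy⟩)⟩

theorem core_subset_skeleton [T2Space L] : R.core ⊆ (skeletonLT (Set.univ : Set L) 5 : Set L) := by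
  rintro _ ⟨⟨c, v, hv⟩, rfl⟩
  have h1 : R.coreMap c v ∈ closedCell c.dim (R.coreCell c) := ⟨v, hv, rfl⟩
  have h2 : c.dim < 5 := by rcases c <;> simp [CoreCell.dim]
  exact skeletonLT_mono (by exact_mod_cast h2) (closedCell_subset_skeletonLT _ _ h1)

theorem Tbar_subset_skeleton [T2Space L] (z : Z) : R.Tbar z ⊆ (skeletonLT (Set.univ : Set L) 5 : Set L) := by
  intro p hp
  rcases R.mem_Tbar_cases hp with hp | ⟨i, hp⟩ | ⟨i, hp⟩
  · exact R.core_subset_skeleton (R.inducedGraph_subset_core z hp)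
  · exact skeletonLT_mono (by norm_num) (openCell_subset_skeletonLT _ _ hp)
  · exact skeletonLT_mono (by norm_num) (openCell_subset_skeletonLT _ _ hp)

theorem mem_core_or_mem_Tbar [T2Space L] {p : L} (hp : p ∈ (skeletonLT (Set.univ : Set L) 5 : Set L)) :
    p ∈ R.core ∨ ∃ z, p ∈ R.Tbar z := by
  obtain ⟨n, hn, c, hc⟩ := CWComplex.mem_skeletonLT_iff.1 hp
  have hn : n < 5 := by exact_mod_cast hn
  have hc := openCell_subset_closedCell _ _ hc
  have aux : ∀ d : CoreCell ℓ, p ∈ closedCell d.dim (R.coreCell d) → p ∈ R.core := by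
    rintro d ⟨v, hv, rfl⟩
    exact R.coreMap_mem_core d hv
  interval_cases n
  · obtain ⟨v, rfl⟩ := R.cell0.surjective c
    exact Or.inl (aux (.vert v) hc)
  · obtain ⟨e | ⟨z, i⟩, rfl⟩ := R.cell1.surjective c
    · exact Or.inl (aux (.edge e) hc)
    · exact Or.inr ⟨z, Or.inl (Or.inr (Set.mem_iUnion.2 ⟨i, hc⟩))⟩
  · obtain ⟨⟨z, i⟩, rfl⟩ := R.cell2.surjective c
    exact Or.inr ⟨z, Or.inr (Set.mem_iUnion.2 ⟨i, hc⟩)⟩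
  · obtain ⟨x, rfl⟩ := R.cell3.surjective c
    exact Or.inl (aux (.sph x) hc)
  · obtain ⟨q, rfl⟩ := R.cell4.surjective c
    exact Or.inl (aux (.qubit q) hc)

end Single

/-! ### Identification of the cores of two realizations. -/

section Pair

variable {L₁ L₂ : Type*} [TopologicalSpace L₁] [CWComplex (Set.univ : Set L₁)]
  [TopologicalSpace L₂] [CWComplex (Set.univ : Set L₂)]
  (R₁ : CellularRealization ℓ G L₁) (R₂ : CellularRealization ℓ G L₂)

/-- Every point of a common cell lies in the interior of a common cell, which is the same in all
the realizations. -/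
theorem exists_mem_ball (p : CorePoint ℓ) : ∃ p' : CorePoint ℓ,
    (p'.2 : Fin p'.1.dim → ℝ) ∈ ball 0 1 ∧ R₁.corePt p = R₁.corePt p' ∧
      R₂.corePt p = R₂.corePt p' := by
  have hball : ∀ {n : ℕ} {v : Fin n → ℝ}, v ∈ closedBall (0 : Fin n → ℝ) 1 →
      v ∈ ball (0 : Fin n → ℝ) 1 ∨ v ∈ sphere (0 : Fin n → ℝ) 1 := fun {n v} hv => by
    rw [← ball_union_sphere] at hv; exact hv
  have hvert : ∀ v : X ⊕ Q, ∃ p' : CorePoint ℓ,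
      (p'.2 : Fin p'.1.dim → ℝ) ∈ ball 0 1 ∧ R₁.vert v = R₁.corePt p' ∧
        R₂.vert v = R₂.corePt p' := fun v =>
    ⟨⟨.vert v, 0, by simp⟩, by simp, rfl, rfl⟩
  have hedge : ∀ (e : ℓ.Edge) (v : Fin 1 → ℝ), v ∈ closedBall 0 1 → ∃ p' : CorePoint ℓ,
      (p'.2 : Fin p'.1.dim → ℝ) ∈ ball 0 1 ∧ R₁.coreMap (.edge e) v = R₁.corePt p' ∧
        R₂.coreMap (.edge e) v = R₂.corePt p' := by
    rintro ⟨q, e⟩ v hv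
    rcases hball hv with hv' | hv'
    · exact ⟨⟨.edge ⟨q, e⟩, v, hv⟩, hv', rfl, rfl⟩
    · have hv0 : v = fun _ => v 0 := by ext i; rw [Subsingleton.elim i 0]
      have h1 : |v 0| = 1 := by
        rw [mem_sphere_zero_iff_norm, hv0] at hv'
        simpa using hv'
      rcases eq_or_eq_neg_of_abs_eq h1 with h | h <;> rw [h] at hv0 <;> subst hv0
      · obtain ⟨p', hp', h1, h2⟩ := hvert (Sum.inr q)
        exact ⟨p', hp', (R₁.edge_q q e).trans h1, (R₂.edge_q q e).trans h2⟩
      · obtain ⟨p', hp', h1, h2⟩ := hvert (Sum.inl e.1)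
        exact ⟨p', hp', (R₁.edge_x q e).trans h1, (R₂.edge_x q e).trans h2⟩
  have hsph : ∀ (x : X) (v : Fin 3 → ℝ), v ∈ closedBall 0 1 → ∃ p' : CorePoint ℓ,
      (p'.2 : Fin p'.1.dim → ℝ) ∈ ball 0 1 ∧ R₁.coreMap (.sph x) v = R₁.corePt p' ∧
        R₂.coreMap (.sph x) v = R₂.corePt p' := by
    intro x v hv
    rcases hball hv with hv' | hv'
    · exact ⟨⟨.sph x, v, hv⟩, hv', rfl, rfl⟩
    · obtain ⟨p', hp', h1, h2⟩ := hvert (Sum.inl x)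
      exact ⟨p', hp', (R₁.attach3 x v hv').trans h1, (R₂.attach3 x v hv').trans h2⟩
  obtain ⟨v | e | x | q, v, hv⟩ := p
  · obtain rfl : v = 0 := Subsingleton.elim (α := Fin 0 → ℝ) _ _
    exact hvert _
  · exact hedge e v hv
  · exact hsph x v hv
  · rcases hball hv with hv' | hv'
    · exact ⟨⟨.qubit q, v, hv⟩, hv', rfl, rfl⟩
    -- The boundary of a 4-cell is exhausted by inner little cubes, shells and the remainder. In
    -- each case the same formula sends the point to a 3-cell, an edge or a vertex in both
    -- realizations.
    · by_cases hf : ∃ e : ℓ.Star q, v ∈ ℓ.foot q e '' closedBall 0 1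
      · obtain ⟨e, u, hu, rfl⟩ := hf
        have hu1 := mem_closedBall_zero_iff.1 hu
        rcases le_total ‖u‖ (1 / 2) with h | h
        · obtain ⟨p', hp', h1, h2⟩ := hsph e.1 ((2 : ℝ) • u) (by
            rw [mem_closedBall_zero_iff, norm_smul]; norm_num; linarith)
          exact ⟨p', hp', (R₁.attach4_sphere q e u hu h).trans h1,
            (R₂.attach4_sphere q e u hu h).trans h2⟩
        · obtain ⟨p', hp', h1, h2⟩ := hedge ⟨q, e⟩ (fun _ => 4 * ‖u‖ - 3) (by
            rw [mem_closedBall_zero_iff, pi_norm_const, Real.norm_eq_abs, abs_le]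
            constructor <;> linarith)
          exact ⟨p', hp', (R₁.attach4_edge q e u hu h).trans h1,
            (R₂.attach4_edge q e u hu h).trans h2⟩
      · obtain ⟨p', hp', h1, h2⟩ := hvert (Sum.inr q)
        have hf' : ∀ e : ℓ.Star q, v ∉ ℓ.foot q e '' closedBall 0 1 := fun e he => hf ⟨e, he⟩
        exact ⟨p', hp', (R₁.attach4_vert q v hv' hf').trans h1,
          (R₂.attach4_vert q v hv' hf').trans h2⟩

/-- Once both points are moved to open cells, simultaneously for the two realizations, equality of
images in `L₁` forces equality of the representatives, as open cells are disjoint and embedded. -/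
theorem corePt_eq_of_eq {p p' : CorePoint ℓ} (h : R₁.corePt p = R₁.corePt p') :
    R₂.corePt p = R₂.corePt p' := by
  obtain ⟨⟨c, v, hv⟩, hb, h1, h2⟩ := exists_mem_ball R₁ R₂ p
  obtain ⟨⟨c', v', hv'⟩, hb', h1', h2'⟩ := exists_mem_ball R₁ R₂ p'
  rw [h2, h2']
  rw [h1, h1'] at h
  obtain ⟨rfl, h⟩ := Sigma.mk.inj_iff.1 (R₁.coreMap_injective hb hb' h)
  obtain rfl := eq_of_heq h
  rfl

/-- The finite union of closed cubes is compact and `L₁` is Hausdorff, so the core is its quotient;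
by `corePt_eq_of_eq` the second family of characteristic maps descends to it. -/
theorem exists_coreMap [T2Space L₁] : ∃ h : C(R₁.core, R₂.core),
    ∀ p, h ⟨R₁.corePt p, Set.mem_range_self p⟩ = ⟨R₂.corePt p, Set.mem_range_self p⟩ := by
  have := Fintype.ofFinite (CoreCell ℓ)
  let q₁ : C(CorePoint ℓ, R₁.core) := ⟨fun p => ⟨R₁.corePt p, Set.mem_range_self p⟩, by fun_prop⟩
  let q₂ : C(CorePoint ℓ, R₂.core) := ⟨fun p => ⟨R₂.corePt p, Set.mem_range_self p⟩, by fun_prop⟩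
  have hq : IsQuotientMap q₁ := q₁.continuous.isClosedMap.isQuotientMap q₁.continuous (by
    rintro ⟨_, p, rfl⟩; exact ⟨p, rfl⟩)
  have hl : ∀ x y, q₁ x = q₁ y → q₂ x = q₂ y := fun x y hxy =>
    Subtype.ext (corePt_eq_of_eq R₁ R₂ (congrArg Subtype.val hxy))
  exact ⟨hq.lift q₂ hl, fun p => congrArg (fun k : C(CorePoint ℓ, R₂.core) => k p)
    (hq.lift_comp q₂ hl)⟩

/-- The identification of the unions of the common cells of two realizations. -/
theorem exists_coreHomeo [T2Space L₁] [T2Space L₂] : ∃ h : R₁.core ≃ₜ R₂.core,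
    ∀ p, h ⟨R₁.corePt p, Set.mem_range_self p⟩ = ⟨R₂.corePt p, Set.mem_range_self p⟩ := by
  obtain ⟨h, hh⟩ := exists_coreMap R₁ R₂
  obtain ⟨k, hk⟩ := exists_coreMap R₂ R₁
  refine ⟨⟨⟨h, k, ?_, ?_⟩, h.continuous, k.continuous⟩, hh⟩
  · rintro ⟨_, p, rfl⟩
    rw [hh, hk]
  · rintro ⟨_, p, rfl⟩
    rw [hk, hh]

end Pair

/-! ### Intersections of the core and the subcomplexes `T̄_z`. -/

section Core

variable {L : Type*} [TopologicalSpace L] [CWComplex (Set.univ : Set L)]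
  (R : CellularRealization ℓ G L)

theorem exists_mem_openCell_of_mem_core {p : L} (hp : p ∈ R.core) :
    ∃ c : CoreCell ℓ, p ∈ openCell c.dim (R.coreCell c) := by
  obtain ⟨p, rfl⟩ := hp
  obtain ⟨⟨c, v, hv⟩, hb, h, -⟩ := exists_mem_ball R R p
  exact ⟨c, v, hb, h.symm⟩

/-- The open cells of `T̄_z` outside `T_z` are `Z`-type edges and faces, none of which is a core
cell. -/
theorem core_inter_Tbar {z : Z} {p : L} (hp : p ∈ R.core) (hz : p ∈ R.Tbar z) :
    p ∈ R.inducedGraph z := by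
  obtain ⟨c, hc⟩ := R.exists_mem_openCell_of_mem_core hp
  rcases R.mem_Tbar_cases hz with h | ⟨i, h⟩ | ⟨i, h⟩
  · exact h
  · have := eq_of_mem_openCell hc h
    rcases c <;> simp [CoreCell.dim, CellLabelling.coreCell] at this
  · have := congrArg Sigma.fst (eq_of_mem_openCell hc h)
    rcases c <;> simp [CoreCell.dim] at this

/-- Outside the core, the open cell through a point of `T̄_z` carries the label `z`. -/
theorem Tbar_inter_Tbar {z z' : Z} (hne : z ≠ z') {p : L} (hz : p ∈ R.Tbar z)
    (hz' : p ∈ R.Tbar z') : p ∈ R.core := by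
  rcases R.mem_Tbar_cases hz with h | h
  · exact R.inducedGraph_subset_core z h
  rcases R.mem_Tbar_cases hz' with h' | h'
  · exact R.inducedGraph_subset_core z' h'
  exfalso
  rcases h with ⟨i, h⟩ | ⟨i, h⟩ <;> rcases h' with ⟨i', h'⟩ | ⟨i', h'⟩ <;>
    have := eq_of_mem_openCell h h' <;> simp [hne] at this

end Core

end CellularRealization

end Realization

open RelCWComplex

/-! ### Disjoint unions, and the complex and its 4-skeleton as pushouts. -/

/-- The disjoint union of a family of maps. -/
def sigmaMap {ι : Type*} {A B : ι → Type*} [∀ i, TopologicalSpace (A i)]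
    [∀ i, TopologicalSpace (B i)] (f : ∀ i, C(A i, B i)) : C(Σ i, A i, Σ i, B i) :=
  ⟨fun p => ⟨p.1, f p.1 p.2⟩, continuous_sigma fun i => continuous_sigmaMk.comp (f i).continuous⟩

/-- The map from a disjoint union given by a family of maps. -/
def sigmaDesc {ι : Type*} {A : ι → Type*} {B : Type*} [∀ i, TopologicalSpace (A i)]
    [TopologicalSpace B] (f : ∀ i, C(A i, B)) : C(Σ i, A i, B) :=
  ⟨fun p => f p.1 p.2, continuous_sigma fun i => (f i).continuous⟩

/-- The inclusion of a summand. -/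
def sigmaIncl {ι : Type*} (A : ι → Type*) [∀ i, TopologicalSpace (A i)] (i : ι) :
    C(A i, Σ i, A i) := ⟨Sigma.mk i, continuous_sigmaMk⟩

/-- The disjoint union of a family of homotopies. -/
def sigmaHomotopy {ι : Type*} {A B : ι → Type*} [∀ i, TopologicalSpace (A i)]
    [∀ i, TopologicalSpace (B i)] (k : ∀ i, C(A i, C(I, B i))) : C(Σ i, A i, C(I, Σ i, B i)) :=
  sigmaDesc fun i => ContinuousMap.curry
    ((sigmaIncl B i).comp (k i).uncurry)

theorem sigmaHomotopy_apply {ι : Type*} {A B : ι → Type*} [∀ i, TopologicalSpace (A i)]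
    [∀ i, TopologicalSpace (B i)] (k : ∀ i, C(A i, C(I, B i))) (p : Σ i, A i) (t : I) :
    sigmaHomotopy k p t = ⟨p.1, k p.1 p.2 t⟩ := rfl

namespace CellularRealization

variable {X Q Z : Type*} [Fintype X] [Fintype Q] {C : CSSCode X Q Z} {ℓ : ZLift C}
  {G : ∀ z : Z, CheckGluing ℓ z}

section Single

theorem compactSpace {L : Type*} [TopologicalSpace L] [CWComplex (Set.univ : Set L)] [Finite Z]
    (R : CellularRealization ℓ G L) : CompactSpace L := by
  have := R.finite_cell
  have h : (Set.univ : Set L) = ⋃ n : Fin 6, ⋃ c : cell (Set.univ : Set L) n, closedCell n c := by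
    refine (Set.eq_univ_of_forall fun p => ?_).symm
    obtain ⟨n, c, hc⟩ := exists_mem_openCell p
    have hn : n < 6 := by
      by_contra hn
      exact (R.cell_isEmpty n (by omega)).false c
    exact Set.mem_iUnion₂.2 ⟨⟨n, hn⟩, c, openCell_subset_closedCell _ _ hc⟩
  rw [← isCompact_univ_iff, h]
  exact isCompact_iUnion fun n => isCompact_iUnion fun c => isCompact_closedCell

variable {L : Type u} [TopologicalSpace L] [T2Space L] [CWComplex (Set.univ : Set L)]
  (R : CellularRealization ℓ G L)

theorem hep_inducedGraph [Finite Z] (z : Z) :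
    HEP.{_, _, w} (incl (R.inducedGraph_subset_Tbar z)) := by
  have := R.finite_cell
  exact hep_incl_of_isCellular _ (R.isClosed_inducedGraph z) (R.isClosed_Tbar z)
    (R.isCellular_inducedGraph z) (R.isCellular_Tbar z) 6 fun n hn => R.cell_isEmpty n (by omega)

theorem hep_Tbar [Finite Z] (z : Z) : HEP.{_, _, w} (incl (R.Tbar_subset_skeleton z)) := by
  have := R.finite_cell
  exact hep_incl_of_isCellular _ (R.isClosed_Tbar z) (skeletonLT (Set.univ : Set L) 5).closed
    (R.isCellular_Tbar z) (isCellular_skeletonLT 5) 6 fun n hn => R.cell_isEmpty n (by omega)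

/-- The `4`-skeleton is obtained from the common cells by gluing in the subcomplexes `T̄_z` along
the graphs `T_z`. -/
theorem isGlue_Tbar [Finite Z] {M : Type*} [TopologicalSpace M] {T : Z → Type*}
    [∀ z, TopologicalSpace (T z)] (e : M ≃ₜ R.core) (j : ∀ z, C(T z, M))
    (τ : ∀ z, C(T z, R.Tbar z)) (hτ : ∀ z t, (τ z t : L) = e (j z t))
    (hj : ∀ z, ∀ p ∈ R.inducedGraph z, ∃ t, (e (j z t) : L) = p) :
    IsGlue (sigmaMap τ) (sigmaDesc j) ((incl R.core_subset_skeleton).comp (e : C(M, R.core)))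
      (sigmaDesc fun z => incl (R.Tbar_subset_skeleton z)) := by
  have := R.compactSpace
  have := fun z => isCompact_iff_compactSpace.1 (R.isClosed_Tbar z).isCompact
  have := Fintype.ofFinite Z
  -- All identifications between pieces happen in the core, and `T̄_z` meets the core only in `T_z`.
  have hrange : ∀ d : Σ z, R.Tbar z, (d.2 : L) ∈ R.core → d ∈ Set.range (sigmaMap τ) := by
    rintro ⟨z, p, hp⟩ h
    obtain ⟨t, ht⟩ := hj z p (R.core_inter_Tbar h hp)
    exact ⟨⟨z, t⟩, Sigma.ext rfl (heq_of_eq (Subtype.ext ((hτ z t).trans ht)))⟩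
  refine IsGlue.of_injective ?_ (isQuotientMap_sumElim ?_ _ ?_) ?_ ?_ ?_
  · rintro ⟨z, t⟩
    exact Subtype.ext (hτ z t).symm
  · exact (Topology.IsClosedEmbedding.inclusion R.core_subset_skeleton
      (R.isClosed_core.preimage continuous_subtype_val)).isClosedMap.comp e.isClosedMap
  · rintro ⟨p, hp⟩
    rcases R.mem_core_or_mem_Tbar hp with h | ⟨z, h⟩
    · exact Or.inl ⟨e.symm ⟨p, h⟩, Subtype.ext (by simp [incl])⟩
    · exact Or.inr ⟨⟨z, p, h⟩, rfl⟩
  · exact (Set.inclusion_injective R.core_subset_skeleton).comp e.injective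
  · intro d x h
    have h' : (d.2 : L) = e x := congrArg Subtype.val h
    exact hrange d (h' ▸ (e x).2)
  · rintro ⟨z, p⟩ ⟨z', p'⟩ h
    have h' : (p : L) = p' := congrArg Subtype.val h
    by_cases hz : z = z'
    · subst hz
      exact Or.inl (by rw [Subtype.ext h'])
    · have hc := R.Tbar_inter_Tbar hz p.2 (h' ▸ p'.2)
      exact Or.inr ⟨hrange _ hc, hrange _ (show (p' : L) ∈ R.core from h' ▸ hc)⟩

theorem frontier_cell5 (z : Z) :
    cellFrontier 5 (R.cell5 z) ⊆ (skeletonLT (Set.univ : Set L) 5 : Set L) :=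
  cellFrontier_subset_skeletonLT 5 _

/-- The whole complex is obtained from its `4`-skeleton by attaching the `5`-cells. -/
theorem isGlue_cell5 [Finite Z] : IsGlue (sphereIncls Z 5) (attachMaps R.cell5 R.frontier_cell5)
    (incl (Set.subset_univ (skeletonLT (Set.univ : Set L) 5 : Set L)))
    (cellMaps R.cell5 fun _ => Set.subset_univ _) := by
  refine isGlue_cells _ R.cell5.injective (skeletonLT (Set.univ : Set L) 5).closed _ _ _
    (fun z => (disjoint_skeletonLT_openCell le_rfl).symm) fun p _ => ?_
  obtain ⟨n, c, hc⟩ := exists_mem_openCell p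
  rcases lt_trichotomy n 5 with hn | rfl | hn
  · exact Or.inl (skeletonLT_mono (by exact_mod_cast hn) (openCell_subset_skeletonLT n c hc))
  · obtain ⟨z, rfl⟩ := R.cell5.surjective c
    exact Or.inr ⟨z, openCell_subset_closedCell _ _ hc⟩
  · exact ((R.cell_isEmpty n hn).false c).elim

end Single

/-! ### Comparison of two realizations. -/

section Pair

variable {L₁ : Type u} {L₂ : Type v} [TopologicalSpace L₁] [CWComplex (Set.univ : Set L₁)]
  [TopologicalSpace L₂] [CWComplex (Set.univ : Set L₂)]
  (R₁ : CellularRealization ℓ G L₁) (R₂ : CellularRealization ℓ G L₂)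

/-- A point of the attaching sphere of a `5`-cell goes to the same point of the common cells in both
realizations, or it goes to the subcomplex `T̄_z` in both of them. -/
theorem attach5_cases (z : Z) {s : Fin 5 → ℝ} (hs : s ∈ sphere (0 : Fin 5 → ℝ) 1) :
    (∃ p : CorePoint ℓ, map 5 (R₁.cell5 z) s = R₁.corePt p ∧
      map 5 (R₂.cell5 z) s = R₂.corePt p) ∨
    (map 5 (R₁.cell5 z) s ∈ R₁.Tbar z ∧ map 5 (R₂.cell5 z) s ∈ R₂.Tbar z) := by
  by_cases h : ∃ v ∈ (G z).thick, s = app v 1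
  · left
    obtain ⟨v, hv | hv, rfl⟩ := h
    · obtain ⟨j, u, hu, rfl⟩ := Set.mem_iUnion.1 hv
      exact ⟨⟨.qubit j.1, u, hu⟩, R₁.attach5_ball z j u hu, R₂.attach5_ball z j u hu⟩
    · obtain ⟨e, ⟨t, u⟩, ⟨ht, hu⟩, rfl⟩ := Set.mem_iUnion.1 hv
      exact ⟨⟨.sph e.2.1, u, hu⟩, R₁.attach5_tube z e t ht u hu, R₂.attach5_tube z e t ht u hu⟩
  · right
    have h' : ∀ v ∈ (G z).thick, s ≠ app v 1 := fun v hv he => h ⟨v, hv, he⟩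
    exact ⟨R₁.attach5_rest z s hs h', R₂.attach5_rest z s hs h'⟩

variable [T2Space L₁] [T2Space L₂]

/-- The identification of the common cells extends to a homotopy equivalence of the `4`-skeleta if
the subcomplexes `T̄_z` are contractible. -/
theorem exists_skeletonEquiv [Finite Z] (h₁ : ∀ z : Z, ContractibleSpace (R₁.Tbar z))
    (h₂ : ∀ z : Z, ContractibleSpace (R₂.Tbar z)) :
    ∃ F : (skeletonLT (Set.univ : Set L₁) 5 : Set L₁) ≃ₕ (skeletonLT (Set.univ : Set L₂) 5 : Set L₂),
      (∀ (p : (skeletonLT (Set.univ : Set L₁) 5 : Set L₁)) q, (p : L₁) = R₁.corePt q → (F p : L₂) = R₂.corePt q) ∧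
      ∀ z (p : (skeletonLT (Set.univ : Set L₁) 5 : Set L₁)), (p : L₁) ∈ R₁.Tbar z → (F p : L₂) ∈ R₂.Tbar z := by
  obtain ⟨e, he⟩ := exists_coreHomeo R₁ R₂
  have hgraph : ∀ z (p : R₁.core), (p : L₁) ∈ R₁.inducedGraph z ↔ (e p : L₂) ∈ R₂.inducedGraph z := by
    intro z p
    constructor
    · intro h
      obtain ⟨c, v, hc, hv, hp⟩ := R₁.mem_inducedGraph.1 h
      obtain rfl : p = ⟨R₁.corePt ⟨c, v, hv⟩, Set.mem_range_self _⟩ := Subtype.ext hp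
      rw [he]
      exact R₂.mem_inducedGraph.2 ⟨c, v, hc, hv, rfl⟩
    · intro h
      obtain ⟨c, v, hc, hv, hp⟩ := R₂.mem_inducedGraph.1 h
      have : e p = e ⟨R₁.corePt ⟨c, v, hv⟩, Set.mem_range_self _⟩ := by
        rw [he]; exact Subtype.ext hp
      rw [e.injective this]
      exact R₁.mem_inducedGraph.2 ⟨c, v, hc, hv, rfl⟩
  let j (z : Z) : C(R₁.inducedGraph z, R₁.core) := incl (R₁.inducedGraph_subset_core z)
  let ε (z : Z) : R₁.inducedGraph z ≃ₜ R₂.inducedGraph z :=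
    { toFun := fun p => ⟨e (j z p), (hgraph z _).1 p.2⟩
      invFun := fun p => ⟨e.symm (incl (R₂.inducedGraph_subset_core z) p), by
        rw [hgraph, e.apply_symm_apply]; exact p.2⟩
      left_inv := fun p => Subtype.ext (by
        change ((e.symm (e (j z p)) : R₁.core) : L₁) = p
        rw [e.symm_apply_apply]; rfl)
      right_inv := fun p => Subtype.ext (by
        change ((e (e.symm (incl (R₂.inducedGraph_subset_core z) p)) : R₂.core) : L₂) = p
        rw [e.apply_symm_apply]; rfl)
      continuous_toFun := by fun_prop
      continuous_invFun := by fun_prop }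
  let τ₁ (z : Z) : C(R₁.inducedGraph z, R₁.Tbar z) := incl (R₁.inducedGraph_subset_Tbar z)
  let τ₂ (z : Z) : C(R₁.inducedGraph z, R₂.Tbar z) :=
    (incl (R₂.inducedGraph_subset_Tbar z)).comp (ε z : C(_, _))
  -- Targets in both universes occur: extensions go across to the other complex, homotopies stay
  -- within one.
  have hτ₁u : ∀ z, HEP.{_, _, u} (τ₁ z) := R₁.hep_inducedGraph
  have hτ₁v : ∀ z, HEP.{_, _, v} (τ₁ z) := R₁.hep_inducedGraph
  have hτ₂u : ∀ z, HEP.{_, _, u} (τ₂ z) := fun z => (R₂.hep_inducedGraph z).comp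
    (HEP.homeomorph (ε z))
  have hτ₂v : ∀ z, HEP.{_, _, v} (τ₂ z) := fun z => (R₂.hep_inducedGraph z).comp
    (HEP.homeomorph (ε z))
  -- Both 4-skeleta become pushouts over the same map from the graphs `T_z` of `R₁` to the core of
  -- `R₁`, as `IsGlue.homotopyEquiv` requires; for `R₂` the core is read through `e`.
  have glue₁ := R₁.isGlue_Tbar (Homeomorph.refl _) j τ₁ (fun z t => rfl)
    (fun z p hp => ⟨⟨p, hp⟩, rfl⟩)
  have glue₂ := R₂.isGlue_Tbar e j τ₂ (fun z t => rfl) (fun z p hp => ⟨(ε z).symm ⟨p, hp⟩, by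
    change ((ε z ((ε z).symm ⟨p, hp⟩) : R₂.inducedGraph z) : L₂) = p
    rw [(ε z).apply_symm_apply]⟩)
  -- Contractibility enters twice: to extend the identification of the graphs both ways, and to
  -- deform the composites to the identity relative to `T_z`.
  choose f hf using fun z => (hτ₁v z).exists_extension (τ₂ z)
  choose g hg using fun z => (hτ₂u z).exists_extension (τ₁ z)
  choose k₁ k₁0 k₁1 k₁S using fun z => (hτ₁u z).homotopy_rel_of_contractible
    ((g z).comp (f z)) (ContinuousMap.id _) (fun a => by simp [hf, hg])
  choose k₂ k₂0 k₂1 k₂S using fun z => (hτ₂v z).homotopy_rel_of_contractible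
    ((f z).comp (g z)) (ContinuousMap.id _) (fun a => by simp [hf, hg])
  obtain ⟨F, Fa, Fχ⟩ := glue₁.homotopyEquiv glue₂ (sigmaMap f) (sigmaMap g)
    (fun s => by simp [sigmaMap, hf]) (fun s => by simp [sigmaMap, hg])
    (sigmaHomotopy k₁)
    (fun d => by simp [sigmaHomotopy_apply, k₁0, sigmaMap]) (fun d => by simp [sigmaHomotopy_apply, k₁1])
    (fun s t => by simp [sigmaHomotopy_apply, sigmaMap, k₁S, hf, hg])
    (sigmaHomotopy k₂)
    (fun d => by simp [sigmaHomotopy_apply, k₂0, sigmaMap]) (fun d => by simp [sigmaHomotopy_apply, k₂1])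
    (fun s t => by simp [sigmaHomotopy_apply, sigmaMap, k₂S, hf, hg])
  refine ⟨F, ?_, ?_⟩
  · rintro p q hpq
    have hp : p = ((incl R₁.core_subset_skeleton).comp
        (Homeomorph.refl R₁.core : C(R₁.core, R₁.core))) ⟨R₁.corePt q, Set.mem_range_self q⟩ :=
      Subtype.ext hpq
    rw [hp, Fa, ContinuousMap.comp_apply]
    exact congrArg Subtype.val (he q)
  · rintro z p hp
    have hp' : p = sigmaDesc (fun z => incl (R₁.Tbar_subset_skeleton z)) ⟨z, p, hp⟩ := rfl
    rw [hp', Fχ]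
    exact (f z ⟨p, hp⟩).2

theorem nonempty_homotopyEquiv [Finite Z] (h₁ : ∀ z : Z, ContractibleSpace (R₁.Tbar z))
    (h₂ : ∀ z : Z, ContractibleSpace (R₂.Tbar z)) : Nonempty (L₁ ≃ₕ L₂) := by
  obtain ⟨F, Fcore, FT⟩ := exists_skeletonEquiv R₁ R₂ h₁ h₂
  have hF : (F.toFun.comp (attachMaps R₁.cell5 R₁.frontier_cell5)).Homotopic
      (attachMaps R₂.cell5 R₂.frontier_cell5) := by
    have key : ∀ z, ((F.toFun.comp (attachMaps R₁.cell5 R₁.frontier_cell5)).comp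
        (sigmaIncl (fun _ : Z => sphere (0 : Fin 5 → ℝ) 1) z)).Homotopic
        ((attachMaps R₂.cell5 R₂.frontier_cell5).comp (sigmaIncl (fun _ : Z => sphere (0 : Fin 5 → ℝ) 1) z)) := by
      intro z
      -- Each 5-cell is treated separately, since only the single subcomplex `T̄_z` is squeezed to a
      -- point; the homotopies are then assembled over the disjoint union.
      refine (R₂.hep_Tbar z).homotopic_of_contractible _ _ fun s => ?_
      rcases attach5_cases R₁ R₂ z s.2 with ⟨p, hp₁, hp₂⟩ | ⟨hs₁, hs₂⟩
      · exact Or.inl (Subtype.ext ((Fcore _ p hp₁).trans hp₂.symm))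
      · exact Or.inr ⟨⟨⟨_, FT z _ hs₁⟩, rfl⟩, ⟨⟨_, hs₂⟩, rfl⟩⟩
    choose k k0 k1 using fun z => homotopic_iff.1 (key z)
    exact homotopic_iff.2 ⟨sigmaDesc k, fun x => k0 x.1 x.2, fun x => k1 x.1 x.2⟩
  obtain ⟨E⟩ := R₁.isGlue_cell5.homotopyEquiv_of_homotopic R₂.isGlue_cell5 (hep_sphereIncls Z 5)
    (hep_sphereIncls Z 5) (hep_sphereIncls Z 5) F hF
  exact ⟨((Homeomorph.Set.univ L₁).symm.toHomotopyEquiv.trans E).trans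
    (Homeomorph.Set.univ L₂).toHomotopyEquiv⟩

end Pair

end CellularRealization

end CSSCell

end

theorem mainTheorem9 {X Q Z : Type*} [Fintype X] [Fintype Q] [Fintype Z]
    (C : CSSCell.CSSCode X Q Z) (ℓ : CSSCell.ZLift C)
    (G : ∀ z : Z, CSSCell.CheckGluing ℓ z)
    {L₁ L₂ : Type*} [TopologicalSpace L₁] [T2Space L₁] [TopologicalSpace L₂] [T2Space L₂]
    [CWComplex (Set.univ : Set L₁)] [CWComplex (Set.univ : Set L₂)]
    (R₁ : CSSCell.CellularRealization ℓ G L₁) (R₂ : CSSCell.CellularRealization ℓ G L₂)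
    (h₁ : ∀ z : Z, ContractibleSpace (R₁.Tbar z))
    (h₂ : ∀ z : Z, ContractibleSpace (R₂.Tbar z)) :
    Nonempty (L₁ ≃ₕ L₂) :=
  CSSCell.CellularRealization.nonempty_homotopyEquiv R₁ R₂ h₁ h₂
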